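/- Let $f(x)=\frac{1}{2\pi}\arcsin(x)+\frac14$ for $x\in[-1,1]$, and let $a_k=f^{(k)}(0)/k!$. Then $a_k\ge 0$ for all $k\ge 0$ and $f(x)=\sum_{k\ge 0}a_kx^k$ on $[-1,1]$. For a probability measure $\nu$ on $\mathbb R$ put $f(\nu)=\sum_{k\ge0}a_k\,\nu^{*k}$ (with $\nu^{*0}=\delta_0$), and for a measure $\mu$ on $\mathbb R$ let $\mu_p$ be its periodization, $\mu_p(A)=\sum_{k\in\mathbb Z}\mu(A-k)$ for Borel sets $A$. A point process is a random locally finite subset of $\mathbb R$, measurable for the $\sigma$-algebra generated by the numbers of points in bounded Borel sets. For a locally finite set $\chi\subset\mathbb R$ and $R>0$ let $B_R=(-R,R)$ and $\gamma_R=\frac1{2R}\sum_{x,y\in\chi\cap B_R}\delta_{y-x}$. We say that $\chi$ has diffraction measure $D$ if, as $R\to\infty$, $\gamma_R$ converges vaguely to a tempered measure $\gamma$ whose Fourier transform, as a tempered distribution with kernel $e^{-2\pi i xt}$, is the positive measure $D$. **Proposition.** Let $\nu$ be a symmetric probability measure on $\mathbb R$ that is continuous (has no atoms), and let $\mu=f(\nu)$.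 Then there is a stationary ergodic process $(X_k)_{k\in\mathbb Z}$ with values in $\{0,1\}$ such that $\chi=\{k\in\mathbb Z: X_k=1\}$ is a point process that almost surely has diffraction measure $\mu_p$. **Example.** Let $\nu$ be the law of the random series $\sum_{n\ge1}n^{-n}X_n$, where the $X_n$ are i.i.d. with $P(X_n=1)=P(X_n=-1)=\frac12$. Then $\nu$ is a symmetric continuous probability measure, so the Proposition applies to it, and $$\mu_p=\frac14\sum_{k\in\mathbb Z}\delta_k+m,\qquad m=\Big(\sum_{k\ge1}a_k\,\nu^{*k}\Big)_p,$$ where $m$ is a nonzero, $1$-periodic measure which is purely singular continuous: it has no atoms and is singular with respect to Lebesgue measure. -/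

import Mathlib

open MeasureTheory ProbabilityTheory Filter Topology
open scoped SchwartzMap FourierTransform

noncomputable section

/-! ### Point processes on the line -/

/-- The locally finite subsets of `ℝ`. -/
structure LocallyFiniteSet where
  carrier : Set ℝ
  finite_inter : ∀ K : Set ℝ, IsCompact K → (carrier ∩ K).Finite

/-- The number of points of `φ` in `A` (meaningful for bounded `A`). -/
def LocallyFiniteSet.count (A : Set ℝ) (φ : LocallyFiniteSet) : ℕ :=
  (A ∩ φ.carrier).ncard

/-- The σ-algebra generated by the counting maps of the bounded Borel sets. -/
instance : MeasurableSpace LocallyFiniteSet :=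
  ⨆ (A : Set ℝ) (_ : MeasurableSet A ∧ Bornology.IsBounded A),
    MeasurableSpace.comap (LocallyFiniteSet.count A) ⊤

/-! ### Autocorrelation and diffraction -/

/-- `γ_R = |B_R|⁻¹ ∑_{x, y ∈ χ ∩ B_R} δ_{y - x}`. -/
def autocorrelationAt (χ : LocallyFiniteSet) (R : ℝ) : Measure ℝ :=
  (volume (Metric.ball (0 : ℝ) R))⁻¹ •
    Measure.sum fun p : ↥(χ.carrier ∩ Metric.ball 0 R) × ↥(χ.carrier ∩ Metric.ball 0 R) =>
      Measure.dirac ((p.2 : ℝ) - (p.1 : ℝ))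

/-- `γ` is the limit of `γ_R` in the vague topology as `R → ∞`. -/
def IsAutocorrelation (χ : LocallyFiniteSet) (γ : Measure ℝ) : Prop :=
  IsLocallyFiniteMeasure γ ∧
    ∀ g : ℝ → ℝ, Continuous g → HasCompactSupport g →
      Tendsto (fun R : ℝ => ∫ x, g x ∂(autocorrelationAt χ R)) atTop (𝓝 (∫ x, g x ∂γ))

/-- The set `χ` has an autocorrelation `γ`, which is a tempered measure, and the Fourier transform
of `γ` (in the sense of tempered distributions, with the kernel `exp (-2πixt)`) is the positive
measure `D`. -/
def IsDiffractionMeasure (χ : LocallyFiniteSet) (D : Measure ℝ) : Prop :=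
  ∃ γ : Measure ℝ, IsAutocorrelation χ γ ∧
    ∃ (_ : γ.HasTemperateGrowth) (_ : D.HasTemperateGrowth),
      𝓕 (γ.toTemperedDistribution : 𝓢'(ℝ, ℂ)) = D.toTemperedDistribution

/-! ### The measures `f(ν)` and `μ_p` -/

/-- `f(x) = arcsin(x) / (2π) + 1/4`. -/
def arcsinFun (x : ℝ) : ℝ := 1 / (2 * Real.pi) * Real.arcsin x + 1 / 4

/-- The coefficients `a_k` of the power series of `f` at `0`. -/
def arcsinCoeff (k : ℕ) : ℝ := iteratedDeriv k arcsinFun 0 / (k.factorial : ℝ)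

/-- The convolution power `ν^{*k}`, with `ν^{*0} = δ_0`. -/
def convPower (ν : Measure ℝ) : ℕ → Measure ℝ
  | 0 => Measure.dirac 0
  | k + 1 => (convPower ν k).conv ν

/-- `f(ν) = ∑_k a_k ν^{*k}`. -/
def arcsinMeasure (ν : Measure ℝ) : Measure ℝ :=
  Measure.sum fun k : ℕ => ENNReal.ofReal (arcsinCoeff k) • convPower ν k

/-- `(f - 1/4)(ν) = ∑_{k ≥ 1} a_k ν^{*k}`. -/
def arcsinMeasureTail (ν : Measure ℝ) : Measure ℝ :=
  Measure.sum fun k : ℕ => ENNReal.ofReal (arcsinCoeff (k + 1)) • convPower ν (k + 1)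

/-- The `1`-periodic measure `μ_p(A) = ∑_{k ∈ ℤ} μ(A - k)`. -/
def periodization (μ : Measure ℝ) : Measure ℝ :=
  Measure.sum fun k : ℤ => μ.map fun x => x + (k : ℝ)

/-! ### The example -/

/-- The uniform law on `{-1, 1}`. -/
def signLaw : Measure ℝ :=
  (2⁻¹ : ENNReal) • Measure.dirac 1 + (2⁻¹ : ENNReal) • Measure.dirac (-1)

/-- The law of `∑_{n ≥ 1} X_n / n^n` with `X_1, X_2, …` independent uniform random signs; the
coordinate `x n` plays the role of `X_{n+1}`. -/
def signSeriesLaw : Measure ℝ :=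
  (Measure.infinitePi fun _ : ℕ => signLaw).map
    fun x => ∑' n : ℕ, x n / ((n : ℝ) + 1) ^ (n + 1)

end

/-! Two standard Gaussian variables with correlation `r` are both positive with probability `1/4 +
arcsin(r)/(2π)`, which is `f(r)`. Symmetry of `ν` makes its Fourier coefficients `ν̂(m)` real, so
there is a stationary centred Gaussian process `Y` on `ℤ` with covariance `ν̂(m - n)`. Let `X_k = 1`
exactly when `Y_k > 0`. Then `P(X_0 = X_m = 1) = f(ν̂(m)) = ∑ a_k ν̂(m)^k`, the `m`-th Fourier
coefficient of `f(ν)`.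

Since `ν` has no atoms, Wiener's lemma makes `ν̂(n)²` small on average, even simultaneously for
finitely many translates. Along a suitable sequence of shifts, a finite block of `Y` and its
translate therefore become asymptotically uncorrelated; being Gaussian, they become independent in
law. This mixing passes to the signs (`IsCentredGaussian.tendsto_measure_inter`) and forces
ergodicity (`preErgodic_of_exists_mixing`).

Birkhoff's theorem, applied to the process and to its time reversal, shows that almost surely each
difference `m` occurs with frequency `f(ν̂(m))`. The autocorrelation is thus `∑ f(ν̂(m)) δ_m`, and
Poisson summation, integrated against `f(ν)`, identifies its Fourier transform as the periodization
of `f(ν)` (`fourier_latticeMeasure`).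

In the example, `a_0 = 1/4` gives the lattice part, and all other terms contain a factor `ν` and
have no atoms. The weights `n^{-n}` decay so fast that `ν` lives within `2(N+1)^{-(N+1)}` of at most
`2^N` points. For fixed `k` the power `ν^{*k}` then lives near at most `2^{Nk}` points, on a set
whose length tends to `0`; hence every power is singular. -/

/-! ### The pointwise ergodic theorem -/

section Birkhoff

variable {α : Type*}

/-- The running maximum `max_{k ≤ n} S_k g` of the Birkhoff sums. -/
noncomputable def birkhoffMax (T : α → α) (g : α → ℝ) : ℕ → α → ℝ
  | 0 => fun _ => 0
  | n + 1 => fun x => max 0 (g x + birkhoffMax T g n (T x))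

theorem birkhoffMax_nonneg (T : α → α) (g : α → ℝ) (n : ℕ) (x : α) : 0 ≤ birkhoffMax T g n x := by
  cases n with
  | zero => exact le_rfl
  | succ n => exact le_max_left _ _

theorem birkhoffMax_le_succ (T : α → α) (g : α → ℝ) (n : ℕ) (x : α) :
    birkhoffMax T g n x ≤ birkhoffMax T g (n + 1) x := by
  induction n generalizing x with
  | zero => exact birkhoffMax_nonneg T g _ x
  | succ n ih => exact max_le_max le_rfl (by gcongr; exact ih (T x))

theorem monotone_birkhoffMax (T : α → α) (g : α → ℝ) (x : α) :
    Monotone fun n => birkhoffMax T g n x :=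
  monotone_nat_of_le_succ fun n => birkhoffMax_le_succ T g n x

theorem birkhoffSum_le_birkhoffMax (T : α → α) (g : α → ℝ) (n : ℕ) (x : α) :
    birkhoffSum T g n x ≤ birkhoffMax T g n x := by
  induction n generalizing x with
  | zero => simp [birkhoffMax]
  | succ n ih =>
    rw [birkhoffSum_succ']
    exact le_max_of_le_right (by gcongr; exact ih (T x))

/-- Heart of the maximal argument: under an invariant measure the left side has nonnegative
integral, while the right side tends to `g` wherever the maxima are unbounded. -/
theorem birkhoffMax_succ_sub (T : α → α) (g : α → ℝ) (n : ℕ) (x : α) :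
    birkhoffMax T g (n + 1) x - birkhoffMax T g n (T x) = max (-birkhoffMax T g n (T x)) (g x) := by
  change max 0 (g x + birkhoffMax T g n (T x)) - _ = _
  rw [← max_sub_sub_right]
  simp

/-- Makes the set of bounded maxima strictly invariant, so that ergodicity gives a zero-one
alternative. -/
theorem bddAbove_birkhoffMax_comp_iff (T : α → α) (g : α → ℝ) (x : α) :
    BddAbove (Set.range fun n => birkhoffMax T g n (T x)) ↔
      BddAbove (Set.range fun n => birkhoffMax T g n x) := by
  constructor
  · rintro ⟨c, hc⟩
    refine ⟨max 0 (g x + c), ?_⟩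
    rintro _ ⟨n, rfl⟩
    refine (birkhoffMax_le_succ T g n x).trans (max_le_max le_rfl ?_)
    gcongr
    exact hc ⟨n, rfl⟩
  · rintro ⟨c, hc⟩
    refine ⟨c - g x, ?_⟩
    rintro _ ⟨n, rfl⟩
    have : birkhoffMax T g (n + 1) x ≤ c := hc ⟨n + 1, rfl⟩
    have h2 : g x + birkhoffMax T g n (T x) ≤ birkhoffMax T g (n + 1) x := le_max_right _ _
    simp only
    linarith

variable [MeasurableSpace α] {μ : Measure α} {T : α → α} {g : α → ℝ}

theorem measurable_birkhoffMax (hT : Measurable T) (hg : Measurable g) (n : ℕ) :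
    Measurable (birkhoffMax T g n) := by
  induction n with
  | zero => exact measurable_const
  | succ n ih => exact measurable_const.max (hg.add (ih.comp hT))

theorem integrable_birkhoffMax (hT : MeasurePreserving T μ μ) (hg : Integrable g μ) (n : ℕ) :
    Integrable (birkhoffMax T g n) μ := by
  induction n with
  | zero => exact integrable_zero _ _ _
  | succ n ih => exact (integrable_zero _ _ _).sup (hg.add (hT.integrable_comp_of_integrable ih))

theorem measurableSet_bddAbove_birkhoffMax (hT : Measurable T) (hg : Measurable g) :
    MeasurableSet {x | BddAbove (Set.range fun n => birkhoffMax T g n x)} :=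
  measurableSet_bddAbove_range fun n => measurable_birkhoffMax hT hg n

theorem ae_bddAbove_birkhoffMax (hT : Ergodic T μ) (hgm : Measurable g) (hg : Integrable g μ)
    (hneg : ∫ x, g x ∂μ < 0) :
    ∀ᵐ x ∂μ, BddAbove (Set.range fun n => birkhoffMax T g n x) := by
  set E := {x | BddAbove (Set.range fun n => birkhoffMax T g n x)} with hE
  have hinv : T ⁻¹' E = E := by
    ext x
    exact bddAbove_birkhoffMax_comp_iff T g x
  rcases hT.toPreErgodic.ae_mem_or_ae_notMem
    (measurableSet_bddAbove_birkhoffMax hT.measurable hgm) hinv with h | h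
  · exact h
  exfalso
  have hmp := hT.toMeasurePreserving
  have hlim : Tendsto (fun n => ∫ x, max (-birkhoffMax T g n (T x)) (g x) ∂μ) atTop
      (𝓝 (∫ x, g x ∂μ)) := by
    -- As the maxima are nonnegative, the integrand lies between `g` and `max 0 g`.
    refine tendsto_integral_of_dominated_convergence (fun x => |g x|) ?_ hg.abs ?_ ?_
    · intro n
      exact (((measurable_birkhoffMax hT.measurable hgm n).comp hT.measurable).neg.max
        hgm).aestronglyMeasurable
    · intro n
      refine Eventually.of_forall fun x => ?_
      have := birkhoffMax_nonneg T g n (T x)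
      rw [Real.norm_eq_abs]
      refine abs_le.2 ⟨le_max_of_le_right (neg_abs_le _), max_le ?_ (le_abs_self _)⟩
      linarith [abs_nonneg (g x)]
    · filter_upwards [h] with x hx
      rw [← bddAbove_birkhoffMax_comp_iff] at hx
      have htop := tendsto_atTop_atTop_of_monotone (monotone_birkhoffMax T g (T x)) (fun b => by
        by_contra! hcon
        exact hx ⟨b, by rintro _ ⟨n, rfl⟩; exact (hcon n).le⟩)
      refine tendsto_const_nhds.congr' ?_
      filter_upwards [htop.eventually_ge_atTop (-g x)] with n hn
      rw [max_eq_right (by linarith)]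
  refine absurd (ge_of_tendsto' hlim fun n => ?_) (not_le.2 hneg)
  simp_rw [← birkhoffMax_succ_sub]
  have hi := integrable_birkhoffMax hmp hg
  rw [integral_sub (g := fun x => birkhoffMax T g n (T x)) (hi _)
    (hmp.integrable_comp_of_integrable (hi n))]
  have : ∫ x, birkhoffMax T g n (T x) ∂μ = ∫ x, birkhoffMax T g n x ∂μ := by
    conv_rhs => rw [← hmp.map_eq]
    rw [integral_map hmp.measurable.aemeasurable
      (measurable_birkhoffMax hT.measurable hgm n).aestronglyMeasurable]
  rw [this, sub_nonneg]
  exact integral_mono (hi _) (hi _) fun x => birkhoffMax_le_succ T g n x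

/-- With `c = ∫ g + ε/2` the function `g - c` has negative integral, so its Birkhoff sums have an
upper bound `B` and the averages of `g` are at most `c + B/n`. -/
theorem ae_eventually_birkhoffAverage_le [IsProbabilityMeasure μ] (hT : Ergodic T μ)
    (hgm : Measurable g) (hg : Integrable g μ) {ε : ℝ} (hε : 0 < ε) :
    ∀ᵐ x ∂μ, ∀ᶠ n : ℕ in atTop, birkhoffAverage ℝ T g n x ≤ ∫ y, g y ∂μ + ε := by
  set c := ∫ y, g y ∂μ + ε / 2 with hc
  have hb := ae_bddAbove_birkhoffMax (g := fun x => g x - c) hT (hgm.sub_const _)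
    (hg.sub (integrable_const _)) (by
      rw [integral_sub hg (integrable_const _)]
      simp [hc, hε])
  filter_upwards [hb] with x ⟨B, hB⟩
  have hlim : Tendsto (fun n : ℕ => c + B / n) atTop (𝓝 (c + 0)) :=
    tendsto_const_nhds.add (tendsto_const_div_atTop_nhds_zero_nat B)
  have hlt : c + 0 < ∫ y, g y ∂μ + ε := by rw [hc]; linarith
  filter_upwards [hlim.eventually_le_const hlt, eventually_gt_atTop 0] with n hn hn0
  refine le_trans ?_ hn
  have h1 : birkhoffSum T (fun x => g x - c) n x ≤ B :=
    (birkhoffSum_le_birkhoffMax _ _ _ _).trans (hB ⟨n, rfl⟩)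
  have h2 : birkhoffSum T (fun x => g x - c) n x = birkhoffSum T g n x - n * c := by
    simp [birkhoffSum]
  have hn' : (0 : ℝ) < n := by exact_mod_cast hn0
  rw [birkhoffAverage, smul_eq_mul, inv_mul_le_iff₀ hn']
  rw [h2] at h1
  have : (n : ℝ) * (c + B / n) = n * c + B := by field_simp
  linarith

/-- **Birkhoff's pointwise ergodic theorem** for an ergodic map of a probability space. -/
theorem ae_tendsto_birkhoffAverage [IsProbabilityMeasure μ] (hT : Ergodic T μ)
    (hgm : Measurable g) (hg : Integrable g μ) :
    ∀ᵐ x ∂μ, Tendsto (fun n => birkhoffAverage ℝ T g n x) atTop (𝓝 (∫ y, g y ∂μ)) := by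
  have h1 := ae_all_iff.2 fun k : ℕ =>
    ae_eventually_birkhoffAverage_le hT hgm hg (Nat.one_div_pos_of_nat (α := ℝ) (n := k))
  -- The upper bound for `-g` is the lower bound for `g`; tolerances `1/(k+1)` keep the exceptional
  -- set a countable union.
  have h2 := ae_all_iff.2 fun k : ℕ =>
    ae_eventually_birkhoffAverage_le hT hgm.neg hg.neg (Nat.one_div_pos_of_nat (α := ℝ) (n := k))
  filter_upwards [h1, h2] with x hx1 hx2
  rw [Metric.tendsto_atTop']
  intro ε hε
  obtain ⟨k, hk⟩ := exists_nat_one_div_lt hε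
  obtain ⟨N, hN⟩ := eventually_atTop.1 ((hx1 k).and (hx2 k))
  refine ⟨N, fun n hn => ?_⟩
  obtain ⟨a, b⟩ := hN n hn.le
  simp only [birkhoffAverage_neg, Pi.neg_apply, integral_neg] at b
  rw [Real.dist_eq, abs_lt]
  constructor <;> linarith

end Birkhoff

/-! ### The power series of the arcsine -/

/-- Times `n!`, this is the rising factorial of `1/2`, a product of positive numbers. -/
theorem Real.choose_half_add_nonneg (n : ℕ) : 0 ≤ Ring.choose ((1 / 2 : ℝ) + n - 1) n := by
  have h : Ring.choose ((1 / 2 : ℝ) + n - 1) n = Ring.multichoose (1 / 2 : ℝ) n := by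
    rw [Ring.choose]
    congr 1
    ring
  have h2 := Ring.factorial_nsmul_multichoose_eq_ascPochhammer (1 / 2 : ℝ) n
  rw [Polynomial.ascPochhammer_smeval_eq_eval] at h2
  have h3 := ascPochhammer_pos n (1 / 2 : ℝ) (by norm_num)
  rw [← h2, nsmul_eq_mul] at h3
  rw [h]
  exact (pos_of_mul_pos_right h3 (Nat.cast_nonneg _)).le

/-- The Taylor coefficients at `0` of `1 / √(1 - x²)`. -/
noncomputable def invSqrtCoeff (k : ℕ) : ℝ :=
  if Even k then Ring.choose ((1 / 2 : ℝ) + (k / 2 : ℕ) - 1) (k / 2) else 0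

theorem invSqrtCoeff_nonneg (k : ℕ) : 0 ≤ invSqrtCoeff k := by
  unfold invSqrtCoeff
  split_ifs
  · exact Real.choose_half_add_nonneg _
  · exact le_rfl

/-- The binomial series of `(1 - y)^(-1/2)` at `y = x²`. -/
theorem hasSum_invSqrtCoeff {x : ℝ} (hx : |x| < 1) :
    HasSum (fun k => invSqrtCoeff k * x ^ k) (1 / √(1 - x ^ 2)) := by
  have hsq : |x ^ 2| < 1 := by
    rw [abs_pow]
    exact pow_lt_one₀ (abs_nonneg _) hx two_ne_zero
  have h := (Real.one_div_one_sub_rpow_hasFPowerSeriesOnBall_zero (1 / 2)).hasSum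
    (y := x ^ 2) (by simpa [← ofReal_norm] using hsq)
  simp only [FormalMultilinearSeries.ofScalars_apply_eq, zero_add, smul_eq_mul] at h
  rw [← Real.sqrt_eq_rpow] at h
  have hinj : Function.Injective fun n : ℕ => 2 * n := fun a b hab => by simpa using hab
  rw [← hinj.hasSum_iff]
  · refine h.congr_fun fun n => ?_
    simp [invSqrtCoeff, pow_mul]
  · intro k hk
    have : ¬ Even k := fun ⟨m, hm⟩ => hk ⟨m, by simp only; omega⟩
    simp [invSqrtCoeff, this]

/-- Termwise integration: on `(-r, r)` with `|x| < r < 1` the series may be differentiated term by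
term, its derivative is that of `arcsin`, and both vanish at `0`. -/
theorem hasSum_arcsin {x : ℝ} (hx : |x| < 1) :
    HasSum (fun k : ℕ => invSqrtCoeff k * (x ^ (k + 1) / (k + 1))) (Real.arcsin x) := by
  have hderiv : ∀ r : ℝ, 0 < r → r < 1 → ∀ y ∈ Set.Ioo (-r) r,
      HasDerivAt (fun z => ∑' k : ℕ, invSqrtCoeff k * (z ^ (k + 1) / (k + 1)))
        (∑' k : ℕ, invSqrtCoeff k * y ^ k) y := by
    intro r hr0 hr1 y hy
    refine hasDerivAt_tsum_of_isPreconnected (u := fun k => invSqrtCoeff k * r ^ k)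
      (g := fun k z => invSqrtCoeff k * (z ^ (k + 1) / (k + 1)))
      (g' := fun k z => invSqrtCoeff k * z ^ k)
      (t := Set.Ioo (-r) r) (y₀ := 0)
      (hasSum_invSqrtCoeff (by rwa [abs_of_pos hr0])).summable isOpen_Ioo isPreconnected_Ioo
      ?_ ?_ (by simpa using hr0) ?_ hy
    · intro n z _
      have := ((hasDerivAt_pow (n + 1) z).div_const ((n : ℝ) + 1)).const_mul (invSqrtCoeff n)
      refine this.congr_deriv ?_
      have : (n : ℝ) + 1 ≠ 0 := by positivity
      push_cast
      field_simp
    · intro n z hz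
      rw [norm_mul, norm_pow, Real.norm_of_nonneg (invSqrtCoeff_nonneg n)]
      have := invSqrtCoeff_nonneg n
      gcongr
      exact (abs_lt.2 hz).le
    · convert summable_zero with k
      simp
  obtain ⟨r, hxr, hr1⟩ := exists_between hx
  have hr0 : 0 < r := (abs_nonneg x).trans_lt hxr
  have hsum : Summable fun k : ℕ => invSqrtCoeff k * (x ^ (k + 1) / (k + 1)) := by
    refine Summable.of_norm_bounded ((hasSum_invSqrtCoeff (x := r)
      (by rwa [abs_of_pos hr0])).summable) fun k => ?_
    rw [norm_mul, norm_div, norm_pow, Real.norm_of_nonneg (invSqrtCoeff_nonneg k)]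
    refine mul_le_mul_of_nonneg_left ?_ (invSqrtCoeff_nonneg k)
    have h1 : ‖(k : ℝ) + 1‖ = (k : ℝ) + 1 := Real.norm_of_nonneg (by positivity)
    rw [h1, div_le_iff₀ (by positivity), Real.norm_eq_abs]
    calc |x| ^ (k + 1) ≤ r ^ (k + 1) := by gcongr
      _ ≤ r ^ k := pow_le_pow_of_le_one hr0.le hr1.le (Nat.le_succ k)
      _ ≤ r ^ k * (k + 1) := le_mul_of_one_le_right (by positivity) (by simp)
  have heq : Set.EqOn (fun z => ∑' k : ℕ, invSqrtCoeff k * (z ^ (k + 1) / (k + 1))) Real.arcsin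
      (Set.Ioo (-r) r) := by
    have hd1 : ∀ y ∈ Set.Ioo (-r) r, HasDerivAt Real.arcsin (1 / √(1 - y ^ 2)) y := fun y hy =>
      Real.hasDerivAt_arcsin (by linarith [hy.1]) (by linarith [hy.2])
    refine isOpen_Ioo.eqOn_of_deriv_eq isPreconnected_Ioo
      (fun y hy => (hderiv r hr0 hr1 y hy).differentiableAt.differentiableWithinAt)
      (fun y hy => (hd1 y hy).differentiableAt.differentiableWithinAt) (fun y hy => ?_)
      (x := 0) (by simpa using hr0) (by simp)
    rw [(hderiv r hr0 hr1 y hy).deriv, (hd1 y hy).deriv]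
    exact (hasSum_invSqrtCoeff ((abs_lt.2 hy).trans hr1)).tsum_eq
  have := heq (abs_lt.1 hxr)
  simp only at this
  rw [← this]
  exact hsum.hasSum

/-- The Taylor coefficients at `0` of `arcsinFun`, computed from those of `1 / √(1 - x²)`. -/
noncomputable def arcsinSeriesCoeff : ℕ → ℝ
  | 0 => 1 / 4
  | k + 1 => 1 / (2 * Real.pi) * (invSqrtCoeff k / (k + 1))

theorem arcsinSeriesCoeff_nonneg (k : ℕ) : 0 ≤ arcsinSeriesCoeff k := by
  cases k with
  | zero => norm_num [arcsinSeriesCoeff]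
  | succ k =>
    have := invSqrtCoeff_nonneg k
    have := Real.pi_pos
    simp only [arcsinSeriesCoeff]
    positivity

theorem hasSum_arcsinSeriesCoeff {x : ℝ} (hx : |x| < 1) :
    HasSum (fun k => arcsinSeriesCoeff k * x ^ k) (arcsinFun x) := by
  have h := (hasSum_arcsin hx).mul_left (1 / (2 * Real.pi))
  rw [← hasSum_nat_add_iff' 1]
  have h1 : ∀ k : ℕ, arcsinSeriesCoeff (k + 1) * x ^ (k + 1) =
      1 / (2 * Real.pi) * (invSqrtCoeff k * (x ^ (k + 1) / (k + 1))) := fun k => by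
    simp only [arcsinSeriesCoeff]
    ring
  have h2 : arcsinFun x - ∑ i ∈ Finset.range 1, arcsinSeriesCoeff i * x ^ i =
      1 / (2 * Real.pi) * Real.arcsin x := by
    simp [arcsinFun, arcsinSeriesCoeff]
  simp_rw [h1, h2]
  exact h

/-- Uniqueness of power series coefficients; positivity is visible only on the explicit side. -/
theorem arcsinCoeff_eq (k : ℕ) : arcsinCoeff k = arcsinSeriesCoeff k := by
  have hps : HasFPowerSeriesAt arcsinFun (.ofScalars ℝ arcsinSeriesCoeff) 0 := by
    rw [hasFPowerSeriesAt_iff]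
    filter_upwards [Metric.ball_mem_nhds (0 : ℝ) one_pos] with z hz
    have hz' : |z| < 1 := by simpa using hz
    simpa [FormalMultilinearSeries.coeff_ofScalars, mul_comm] using hasSum_arcsinSeriesCoeff hz'
  have h2 := hps.analyticAt.hasFPowerSeriesAt
  have := hps.eq_formalMultilinearSeries h2
  rw [FormalMultilinearSeries.ofScalars_series_eq_iff] at this
  exact (congrFun this k).symm

theorem arcsinCoeff_nonneg (k : ℕ) : 0 ≤ arcsinCoeff k :=
  arcsinCoeff_eq k ▸ arcsinSeriesCoeff_nonneg k

theorem continuous_arcsinFun : Continuous arcsinFun :=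
  (Real.continuous_arcsin.const_mul _).add_const _

/-- By positivity each partial sum at `x < 1` is at most `f(x)`; letting `x` tend to `1` bounds all
partial sums at `1` by `f(1)`. -/
theorem summable_arcsinCoeff : Summable arcsinCoeff := by
  refine summable_of_sum_range_le (c := arcsinFun 1) arcsinCoeff_nonneg fun n => ?_
  have h1 : Tendsto (fun x : ℝ => ∑ k ∈ Finset.range n, arcsinCoeff k * x ^ k) (𝓝[<] 1)
      (𝓝 (∑ k ∈ Finset.range n, arcsinCoeff k)) := by
    have : Continuous fun x : ℝ => ∑ k ∈ Finset.range n, arcsinCoeff k * x ^ k := by fun_prop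
    simpa using (this.tendsto 1).mono_left nhdsWithin_le_nhds
  have h2 : Tendsto arcsinFun (𝓝[<] 1) (𝓝 (arcsinFun 1)) :=
    (continuous_arcsinFun.tendsto 1).mono_left nhdsWithin_le_nhds
  refine le_of_tendsto_of_tendsto h1 h2 ?_
  filter_upwards [Ioo_mem_nhdsLT (zero_lt_one' ℝ)] with x hx
  have h3 := hasSum_arcsinSeriesCoeff (x := x) (abs_lt.2 ⟨by linarith [hx.1], hx.2⟩)
  simp_rw [← arcsinCoeff_eq] at h3
  exact sum_le_hasSum _ (fun k _ => mul_nonneg (arcsinCoeff_nonneg k) (pow_nonneg hx.1.le k)) h3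

theorem summable_arcsinCoeff_mul_pow {x : ℝ} (hx : x ∈ Set.Icc (-1 : ℝ) 1) :
    Summable fun k => arcsinCoeff k * x ^ k := by
  refine Summable.of_norm_bounded summable_arcsinCoeff fun k => ?_
  rw [norm_mul, norm_pow, Real.norm_of_nonneg (arcsinCoeff_nonneg k)]
  exact mul_le_of_le_one_right (arcsinCoeff_nonneg k)
    (pow_le_one₀ (norm_nonneg _) (abs_le.2 hx))

/-- Summable coefficients give uniform convergence, so both sides are continuous on `[-1, 1]` and
the identity extends from the open interval. -/
theorem hasSum_arcsinCoeff {x : ℝ} (hx : x ∈ Set.Icc (-1 : ℝ) 1) :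
    HasSum (fun k => arcsinCoeff k * x ^ k) (arcsinFun x) := by
  have hcont : ContinuousOn (fun x : ℝ => ∑' k, arcsinCoeff k * x ^ k) (Set.Icc (-1) 1) := by
    refine continuousOn_tsum (fun k => by fun_prop) summable_arcsinCoeff fun k y hy => ?_
    rw [norm_mul, norm_pow, Real.norm_of_nonneg (arcsinCoeff_nonneg k)]
    exact mul_le_of_le_one_right (arcsinCoeff_nonneg k)
      (pow_le_one₀ (norm_nonneg _) (abs_le.2 hy))
  have heq : Set.EqOn (fun x : ℝ => ∑' k, arcsinCoeff k * x ^ k) arcsinFun (Set.Ioo (-1) 1) := by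
    intro y hy
    have h := hasSum_arcsinSeriesCoeff (abs_lt.2 hy)
    simp_rw [← arcsinCoeff_eq] at h
    exact h.tsum_eq
  have := heq.of_subset_closure hcont continuous_arcsinFun.continuousOn Set.Ioo_subset_Icc_self
    (by rw [closure_Ioo (by norm_num)]) hx
  simp only at this
  rw [← this]
  exact (summable_arcsinCoeff_mul_pow hx).hasSum

theorem arcsinFun_nonneg (x : ℝ) : 0 ≤ arcsinFun x := by
  have := Real.neg_pi_div_two_le_arcsin x
  have hpi := Real.pi_pos
  have e : arcsinFun x = 1 / (2 * Real.pi) * (Real.arcsin x - -(Real.pi / 2)) := by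
    rw [arcsinFun]
    field_simp
    ring
  rw [e]
  exact mul_nonneg (by positivity) (by linarith)

theorem arcsinFun_le_one (x : ℝ) : arcsinFun x ≤ 1 := by
  have := Real.arcsin_le_pi_div_two x
  have hpi := Real.pi_pos
  have h : 1 / (2 * Real.pi) * Real.arcsin x ≤ 1 / (2 * Real.pi) * (Real.pi / 2) := by gcongr
  have e : 1 / (2 * Real.pi) * (Real.pi / 2) = 1 / 4 := by
    field_simp
    norm_num
  rw [arcsinFun]
  linarith

/-! ### Gaussian processes with a given covariance -/

theorem measurable_toLp_of_forall {ι Ω : Type*} [MeasurableSpace Ω] {Y : ι → Ω → ℝ}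
    (hY : ∀ a, Measurable (Y a)) : Measurable fun ω => WithLp.toLp 2 fun a => Y a ω :=
  (WithLp.measurable_toLp 2 _).comp (measurable_pi_lambda _ hY)

/-- The centred Gaussian processes with covariance kernel `K`, described by the characteristic
functions of their finite-dimensional marginals. -/
structure IsCentredGaussian {T Ω : Type*} [MeasurableSpace Ω] (P : Measure Ω) (Y : T → Ω → ℝ)
    (K : T → T → ℝ) : Prop where
  measurable : ∀ t, Measurable (Y t)
  charFun_eq : ∀ (ι : Type) [Fintype ι] (n : ι → T) (s : EuclideanSpace ℝ ι),
    charFun (P.map fun ω => WithLp.toLp 2 fun a => Y (n a) ω) s =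
      Complex.exp (((-(∑ a, ∑ b, s a * s b * K (n a) (n b)) / 2 : ℝ) : ℂ))

theorem IsCentredGaussian.comp {S T Ω : Type*} [MeasurableSpace Ω] {P : Measure Ω}
    {Y : T → Ω → ℝ} {K : T → T → ℝ} (h : IsCentredGaussian P Y K) (f : S → T) :
    IsCentredGaussian P (fun s => Y (f s)) fun s t => K (f s) (f t) where
  measurable s := h.measurable (f s)
  charFun_eq ι _ n s := h.charFun_eq ι (fun a => f (n a)) s

section Cholesky

variable {H : Type*} [NormedAddCommGroup H] [InnerProductSpace ℝ H]

/-- The coordinates of the vectors `u n` in the normalized Gram-Schmidt basis. -/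
noncomputable def gramSchmidtCoord (u : ℕ → H) (n i : ℕ) : ℝ :=
  inner ℝ (InnerProductSpace.gramSchmidt ℝ u i) (u n) / ‖InnerProductSpace.gramSchmidt ℝ u i‖

theorem gramSchmidtCoord_eq_zero (u : ℕ → H) {n i : ℕ} (h : n < i) :
    gramSchmidtCoord u n i = 0 := by
  rw [gramSchmidtCoord, InnerProductSpace.gramSchmidt_inv_triangular ℝ u h, zero_div]

theorem eq_sum_gramSchmidt (u : ℕ → H) (n : ℕ) :
    u n = ∑ i ∈ Finset.range (n + 1),
      (inner ℝ (InnerProductSpace.gramSchmidt ℝ u i) (u n) /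
        ‖InnerProductSpace.gramSchmidt ℝ u i‖ ^ 2) • InnerProductSpace.gramSchmidt ℝ u i := by
  have h := InnerProductSpace.gramSchmidt_def'' ℝ u n
  rw [Nat.Iio_eq_range] at h
  have h2 : inner ℝ (InnerProductSpace.gramSchmidt ℝ u n) (u n) =
      ‖InnerProductSpace.gramSchmidt ℝ u n‖ ^ 2 := by
    conv_lhs => rw [h]
    rw [inner_add_right, inner_sum, real_inner_self_eq_norm_sq, add_eq_left]
    refine Finset.sum_eq_zero fun i hi => ?_
    rw [inner_smul_right, InnerProductSpace.gramSchmidt_orthogonal ℝ u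
      (Finset.mem_range.1 hi).ne', mul_zero]
  rw [Finset.sum_range_succ, h2]
  -- A vanishing Gram-Schmidt vector contributes nothing, so linear independence of `u` is not
  -- needed.
  by_cases h0 : InnerProductSpace.gramSchmidt ℝ u n = 0
  · simpa [h0] using h
  · rw [div_self (by simpa using h0), one_smul, add_comm]
    exact h

/-- Cholesky factorization of the Gram matrix. Triangularity lets one cutoff `N` serve a whole
finite family. -/
theorem inner_eq_sum_gramSchmidtCoord (u : ℕ → H) {m N : ℕ} (hm : m < N) (n : ℕ) :
    inner ℝ (u m) (u n) =
      ∑ i ∈ Finset.range N, gramSchmidtCoord u m i * gramSchmidtCoord u n i := by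
  have h : inner ℝ (u m) (u n) =
      ∑ i ∈ Finset.range (m + 1), gramSchmidtCoord u m i * gramSchmidtCoord u n i := by
    conv_lhs => rw [eq_sum_gramSchmidt u m]
    rw [sum_inner]
    refine Finset.sum_congr rfl fun i _ => ?_
    rw [real_inner_smul_left, gramSchmidtCoord, gramSchmidtCoord]
    ring
  rw [h]
  refine Finset.sum_subset (Finset.range_mono hm) fun i _ hi => ?_
  rw [gramSchmidtCoord_eq_zero u (by simpa using hi), zero_mul]

end Cholesky

/-- The law of a sequence of independent standard Gaussian variables. -/
noncomputable def gaussianNoise : Measure (ℕ → ℝ) := Measure.infinitePi fun _ => gaussianReal 0 1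

instance : IsProbabilityMeasure gaussianNoise := by
  unfold gaussianNoise
  infer_instance

theorem integral_exp_linear_gaussianNoise (N : ℕ) (d : ℕ → ℝ) :
    ∫ ω, Complex.exp (((∑ k ∈ Finset.range N, d k * ω k : ℝ) : ℂ) * Complex.I) ∂gaussianNoise =
      Complex.exp ((-(∑ k ∈ Finset.range N, d k ^ 2) / 2 : ℝ) : ℂ) := by
  have hind : iIndepFun (fun (k : ℕ) (ω : ℕ → ℝ) => d k * ω k) gaussianNoise :=
    iIndepFun_infinitePi (X := fun k x => d k * x) fun k => measurable_const_mul _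
  have hm : ∀ k, Measurable fun ω : ℕ → ℝ => d k * ω k := fun k => by fun_prop
  have h := congrFun (iIndepFun.charFun_map_fun_finsetSum_eq_prod (s := Finset.range N)
    (P := gaussianNoise) (X := fun (k : ℕ) (ω : ℕ → ℝ) => d k * ω k)
    (fun k _ => (hm k).aemeasurable)
    (hind.restrict _)) 1
  rw [charFun_apply_real, integral_map (Finset.measurable_sum _ fun k _ => hm k).aemeasurable
    (by fun_prop)] at h
  simp only [Complex.ofReal_one, one_mul] at h
  rw [h, Finset.prod_apply]
  have hk : ∀ k, charFun (gaussianNoise.map fun ω => d k * ω k) 1 =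
      Complex.exp ((-(d k ^ 2) / 2 : ℝ) : ℂ) := by
    intro k
    rw [charFun_map_mul_comp (measurable_pi_apply k).aemeasurable, gaussianNoise,
      Measure.infinitePi_map_eval,
      charFun_gaussianReal]
    simp [neg_div]
  simp_rw [hk]
  rw [← Complex.exp_sum]
  congr 1
  push_cast
  rw [neg_div, Finset.sum_div, ← Finset.sum_neg_distrib]
  simp_rw [neg_div]

/-- Triangular combinations of independent noise reproduce any Gram matrix as a covariance, and each
variable uses only finitely many noise coordinates. -/
theorem isCentredGaussian_gaussianNoise {H : Type*} [NormedAddCommGroup H]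
    [InnerProductSpace ℝ H] (u : ℕ → H) :
    IsCentredGaussian gaussianNoise
      (fun n ω => ∑ i ∈ Finset.range (n + 1), gramSchmidtCoord u n i * ω i)
      fun m n => inner ℝ (u m) (u n) where
  measurable n := by fun_prop
  charFun_eq ι _ n s := by
    obtain ⟨N, hN⟩ : ∃ N, ∀ a, n a < N :=
      ⟨Finset.univ.sup n + 1, fun a => Nat.lt_succ_of_le (Finset.le_sup (Finset.mem_univ a))⟩
    rw [charFun_apply, integral_map (measurable_toLp_of_forall fun a => by fun_prop).aemeasurable
      (by fun_prop)]
    have h1 : ∀ ω : ℕ → ℝ, inner ℝ (WithLp.toLp 2 fun a => ∑ i ∈ Finset.range (n a + 1),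
        gramSchmidtCoord u (n a) i * ω i : EuclideanSpace ℝ ι) s =
        ∑ k ∈ Finset.range N, (∑ a, s a * gramSchmidtCoord u (n a) k) * ω k := by
      intro ω
      rw [PiLp.inner_apply]
      simp_rw [Finset.sum_mul]
      rw [Finset.sum_comm]
      refine Finset.sum_congr rfl fun a _ => ?_
      have : ∑ i ∈ Finset.range (n a + 1), gramSchmidtCoord u (n a) i * ω i =
          ∑ i ∈ Finset.range N, gramSchmidtCoord u (n a) i * ω i :=
        Finset.sum_subset (Finset.range_mono (hN a)) fun i _ hi => by
          rw [gramSchmidtCoord_eq_zero u (by simpa using hi), zero_mul]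
      rw [real_inner_eq_re_inner, this]
      simp [Finset.mul_sum, mul_assoc]
    simp_rw [h1]
    rw [integral_exp_linear_gaussianNoise]
    congr 4
    simp_rw [fun a b => inner_eq_sum_gramSchmidtCoord u (hN a) (n b), sq, Finset.sum_mul_sum,
      Finset.mul_sum]
    rw [Finset.sum_comm]
    refine Finset.sum_congr rfl fun a _ => ?_
    rw [Finset.sum_comm]
    refine Finset.sum_congr rfl fun b _ => Finset.sum_congr rfl fun k _ => ?_
    ring

/-! ### The orthant probability -/

theorem gaussianReal_prod_apply {A : Set (ℝ × ℝ)} (hA : MeasurableSet A) :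
    ((gaussianReal 0 1).prod (gaussianReal 0 1)) A =
      ∫⁻ p, ENNReal.ofReal ((2 * Real.pi)⁻¹ * Real.exp (-(p.1 ^ 2 + p.2 ^ 2) / 2)) *
        A.indicator 1 p := by
  rw [gaussianReal_of_var_ne_zero _ one_ne_zero, prod_withDensity (by fun_prop) (by fun_prop),
    withDensity_apply _ hA, ← lintegral_indicator hA]
  refine lintegral_congr fun p => ?_
  by_cases hp : p ∈ A
  · simp only [hp, Set.indicator_of_mem, Pi.one_apply, mul_one, gaussianPDF,
      gaussianPDFReal]
    rw [← ENNReal.ofReal_mul (by positivity)]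
    congr 1
    have h2 : √(2 * Real.pi * (1 : NNReal)) * √(2 * Real.pi * (1 : NNReal)) = 2 * Real.pi := by
      rw [Real.mul_self_sqrt (by positivity)]
      simp
    calc _ = (√(2 * Real.pi * (1 : NNReal)) * √(2 * Real.pi * (1 : NNReal)))⁻¹ *
          (Real.exp (-(p.1 - 0) ^ 2 / (2 * (1 : NNReal))) *
            Real.exp (-(p.2 - 0) ^ 2 / (2 * (1 : NNReal)))) := by rw [mul_inv]; ring
      _ = _ := by
        rw [h2, ← Real.exp_add]
        congr 2
        simp
        ring
  · simp [hp]

/-- The Gaussian measure of a sector. -/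
theorem gaussianReal_prod_sector {A : Set (ℝ × ℝ)} (hA : MeasurableSet A) {Θ : Set ℝ}
    (hΘ : MeasurableSet Θ)
    (h : ∀ r θ : ℝ, 0 < r → θ ∈ Set.Ioo (-Real.pi) Real.pi →
      ((r * Real.cos θ, r * Real.sin θ) ∈ A ↔ θ ∈ Θ)) :
    ((gaussianReal 0 1).prod (gaussianReal 0 1)) A =
      (∫⁻ r in Set.Ioi (0 : ℝ), ENNReal.ofReal (r * ((2 * Real.pi)⁻¹ * Real.exp (-r ^ 2 / 2)))) *
        volume (Θ ∩ Set.Ioo (-Real.pi) Real.pi) := by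
  rw [gaussianReal_prod_apply hA, ← lintegral_comp_polarCoord_symm]
  have hm : Measurable fun r : ℝ =>
      ENNReal.ofReal (r * ((2 * Real.pi)⁻¹ * Real.exp (-r ^ 2 / 2))) := by fun_prop
  -- In polar coordinates the density depends on the radius only and the indicator on the angle
  -- only, so the integral factors.
  have : ∀ p ∈ polarCoord.target, ENNReal.ofReal p.1 •
      (ENNReal.ofReal ((2 * Real.pi)⁻¹ * Real.exp (-((polarCoord.symm p).1 ^ 2 +
        (polarCoord.symm p).2 ^ 2) / 2)) * A.indicator 1 (polarCoord.symm p)) =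
      ENNReal.ofReal (p.1 * ((2 * Real.pi)⁻¹ * Real.exp (-p.1 ^ 2 / 2))) *
        Θ.indicator 1 p.2 := by
    rintro ⟨r, θ⟩ ⟨hr, hθ⟩
    have h1 : (r * Real.cos θ) ^ 2 + (r * Real.sin θ) ^ 2 = r ^ 2 := by
      rw [mul_pow, mul_pow, ← mul_add, Real.cos_sq_add_sin_sq, mul_one]
    have h2 : A.indicator (1 : ℝ × ℝ → ENNReal) (r * Real.cos θ, r * Real.sin θ) =
        Θ.indicator 1 θ := by
      by_cases hm : θ ∈ Θ
      · simp [hm, (h r θ hr hθ).2 hm]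
      · simp [hm, mt (h r θ hr hθ).1 hm]
    simp only [polarCoord_symm_apply, smul_eq_mul]
    rw [h1, h2, ← mul_assoc, ← ENNReal.ofReal_mul (le_of_lt hr)]
  rw [setLIntegral_congr_fun polarCoord.open_target.measurableSet this]
  rw [polarCoord_target, Measure.volume_eq_prod, ← Measure.prod_restrict,
    lintegral_prod_mul hm.aemeasurable (measurable_one.indicator hΘ).aemeasurable,
    lintegral_indicator_one hΘ, Measure.restrict_apply hΘ]

/-- The sector formula for the whole plane has total mass `1`, which determines the radial factor.
-/
theorem lintegral_radial_gaussian :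
    ∫⁻ r in Set.Ioi (0 : ℝ), ENNReal.ofReal (r * ((2 * Real.pi)⁻¹ * Real.exp (-r ^ 2 / 2))) =
      ENNReal.ofReal (2 * Real.pi)⁻¹ := by
  have h := gaussianReal_prod_sector (A := Set.univ) MeasurableSet.univ MeasurableSet.univ
    fun r θ _ _ => by simp
  rw [measure_univ, Set.univ_inter, Real.volume_Ioo] at h
  rw [ENNReal.ofReal_inv_of_pos (by positivity)]
  refine ENNReal.eq_inv_of_mul_eq_one_left ?_
  rw [h]
  congr 2
  ring

/-- The region is the sector `-arcsin r < θ < π/2`, because `r cos θ + √(1 - r²) sin θ = sin (θ +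
arcsin r)`. Its opening `π/2 + arcsin r`, divided by `2π`, is `f(r)`. -/
theorem gaussianReal_prod_orthant {r : ℝ} (hr : r ∈ Set.Icc (-1 : ℝ) 1) :
    ((gaussianReal 0 1).prod (gaussianReal 0 1))
      {p | 0 < p.1 ∧ 0 < r * p.1 + √(1 - r ^ 2) * p.2} = ENNReal.ofReal (arcsinFun r) := by
  have hpi := Real.pi_pos
  have hα1 := Real.neg_pi_div_two_le_arcsin r
  have hα2 := Real.arcsin_le_pi_div_two r
  rw [gaussianReal_prod_sector (Θ := Set.Ioo (-Real.arcsin r) (Real.pi / 2)) ?_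
    measurableSet_Ioo ?_, lintegral_radial_gaussian]
  · have hsub : Set.Ioo (-Real.arcsin r) (Real.pi / 2) ⊆ Set.Ioo (-Real.pi) Real.pi :=
      Set.Ioo_subset_Ioo (by linarith) (by linarith)
    rw [Set.inter_eq_left.2 hsub, Real.volume_Ioo, ← ENNReal.ofReal_mul (by positivity)]
    congr 1
    rw [arcsinFun]
    field_simp
    ring
  · exact (measurableSet_lt measurable_const measurable_fst).inter
      (measurableSet_lt measurable_const
        ((measurable_fst.const_mul r).add (measurable_snd.const_mul _)))
  · intro s θ hs hθ
    have e : r * (s * Real.cos θ) + √(1 - r ^ 2) * (s * Real.sin θ) =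
        s * Real.sin (θ + Real.arcsin r) := by
      rw [Real.sin_add, Real.sin_arcsin hr.1 hr.2, Real.cos_arcsin]
      ring
    simp only [Set.mem_ofPred_eq, e, mul_pos_iff_of_pos_left hs, Set.mem_Ioo]
    constructor
    · rintro ⟨h1, h2⟩
      have h3 : |θ| < Real.pi / 2 := by
        by_contra! hcon
        rw [← Real.cos_abs] at h1
        refine absurd h1 (not_lt.2 (Real.cos_nonpos_of_pi_div_two_le_of_le hcon ?_))
        linarith [(abs_lt.2 hθ)]
      obtain ⟨h4, h5⟩ := abs_lt.1 h3
      refine ⟨?_, h5⟩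
      by_contra! hcon
      exact absurd h2 (not_lt.2 (Real.sin_nonpos_of_nonpos_of_neg_pi_le (by linarith)
        (by linarith)))
    · rintro ⟨h1, h2⟩
      exact ⟨Real.cos_pos_of_mem_Ioo ⟨by linarith, h2⟩,
        Real.sin_pos_of_pos_of_lt_pi (by linarith) (by linarith)⟩

namespace IsCentredGaussian

variable {T Ω Ω' : Type*} [MeasurableSpace Ω] [MeasurableSpace Ω'] {P : Measure Ω}
  {P' : Measure Ω'} {Y : T → Ω → ℝ} {Y' : T → Ω' → ℝ} {K : T → T → ℝ}

theorem integral_exp (h : IsCentredGaussian P Y K) {ι : Type} [Fintype ι] (n : ι → T)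
    (s : ι → ℝ) :
    ∫ ω, Complex.exp (((∑ a, s a * Y (n a) ω : ℝ) : ℂ) * Complex.I) ∂P =
      Complex.exp (((-(∑ a, ∑ b, s a * s b * K (n a) (n b)) / 2 : ℝ) : ℂ)) := by
  have := h.charFun_eq ι n (WithLp.toLp 2 s)
  rw [charFun_apply, integral_map
    (measurable_toLp_of_forall fun a => h.measurable (n a)).aemeasurable (by fun_prop)] at this
  simpa [PiLp.inner_apply] using this

theorem map_toLp_eq [IsProbabilityMeasure P] [IsProbabilityMeasure P']
    (h : IsCentredGaussian P Y K) (h' : IsCentredGaussian P' Y' K)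
    {ι : Type} [Fintype ι] (n : ι → T) :
    P.map (fun ω => WithLp.toLp 2 fun a => Y (n a) ω) =
      P'.map (fun ω => WithLp.toLp 2 fun a => Y' (n a) ω) := by
  have := Measure.isProbabilityMeasure_map (μ := P)
    (measurable_toLp_of_forall fun a => h.measurable (n a)).aemeasurable
  have := Measure.isProbabilityMeasure_map (μ := P')
    (measurable_toLp_of_forall fun a => h'.measurable (n a)).aemeasurable
  refine Measure.ext_of_charFun (E := EuclideanSpace ℝ ι) (funext fun s => ?_)
  rw [h.charFun_eq, h'.charFun_eq]

/-- Characteristic functions determine the finite-dimensional marginals, and these determine the law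
on path space. Hence symmetries of the kernel are symmetries of the law. -/
theorem map_eq {T : Type} {Y : T → Ω → ℝ} {Y' : T → Ω' → ℝ} {K : T → T → ℝ}
    [IsProbabilityMeasure P] [IsProbabilityMeasure P']
    (h : IsCentredGaussian P Y K) (h' : IsCentredGaussian P' Y' K) :
    P.map (fun ω t => Y t ω) = P'.map fun ω t => Y' t ω := by
  have hm : Measurable fun ω t => Y t ω := measurable_pi_lambda _ h.measurable
  have hm' : Measurable fun ω t => Y' t ω := measurable_pi_lambda _ h'.measurable
  have := Measure.isProbabilityMeasure_map (μ := P) hm.aemeasurable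
  have := Measure.isProbabilityMeasure_map (μ := P') hm'.aemeasurable
  refine IsProjectiveLimit.unique
    (P := fun I : Finset T => (P.map fun ω t => Y t ω).map I.restrict) (fun I => rfl) fun I => ?_
  have key := congrArg (fun μ => Measure.map (WithLp.ofLp (p := 2)) μ)
    (h.map_toLp_eq h' (fun i : I => (i : T)))
  rw [Measure.map_map (WithLp.measurable_ofLp 2 _)
    (measurable_toLp_of_forall fun a : I => h.measurable a), Measure.map_map
    (WithLp.measurable_ofLp 2 _) (measurable_toLp_of_forall fun a : I => h'.measurable a)] at key
  change _ = Measure.map I.restrict (Measure.map (fun ω t => Y t ω) P)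
  rw [Measure.map_map (Finset.measurable_restrict I) hm',
    Measure.map_map (Finset.measurable_restrict I) hm]
  exact key.symm

theorem map_eq_gaussianReal [IsProbabilityMeasure P] (h : IsCentredGaussian P Y K) {t : T}
    (ht : K t t = 1) : P.map (Y t) = gaussianReal 0 1 := by
  have := Measure.isProbabilityMeasure_map (μ := P) (h.measurable t).aemeasurable
  refine Measure.ext_of_charFun (funext fun s => ?_)
  have h1 := h.integral_exp (ι := Unit) (fun _ => t) fun _ => s
  rw [charFun_gaussianReal, charFun_apply_real, integral_map (h.measurable t).aemeasurable
    (by fun_prop)]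
  simp only [Finset.univ_unique, Finset.sum_singleton, ht] at h1
  push_cast at h1 ⊢
  rw [h1]
  congr 1
  simp
  ring

theorem measure_eq_zero [IsProbabilityMeasure P] (h : IsCentredGaussian P Y K) {t : T}
    (ht : K t t = 1) : P {ω | Y t ω = 0} = 0 := by
  have h1 : P.map (Y t) {0} = 0 := by
    rw [h.map_eq_gaussianReal ht]
    have := nullSingletonClass_gaussianReal (μ := 0) (v := 1) one_ne_zero
    exact measure_singleton _
  rwa [Measure.map_apply (h.measurable t) (measurableSet_singleton 0)] at h1

/-- The pair law of a standardized Gaussian process. -/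
theorem map_pair_eq [IsProbabilityMeasure P] (h : IsCentredGaussian P Y K) {s t : T}
    (hs : K s s = 1) (ht : K t t = 1) (hst : K t s = K s t) (hK : |K s t| ≤ 1) :
    P.map (fun ω => WithLp.toLp 2 (Y s ω, Y t ω)) =
      ((gaussianReal 0 1).prod (gaussianReal 0 1)).map
        fun p => WithLp.toLp 2 (p.1, K s t * p.1 + √(1 - K s t ^ 2) * p.2) := by
  have hm : Measurable fun ω => WithLp.toLp 2 (Y s ω, Y t ω) :=
    (WithLp.measurable_toLp 2 _).comp ((h.measurable s).prodMk (h.measurable t))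
  have hm' : Measurable fun p : ℝ × ℝ =>
      WithLp.toLp 2 (p.1, K s t * p.1 + √(1 - K s t ^ 2) * p.2) :=
    (WithLp.measurable_toLp 2 _).comp (by fun_prop)
  have := Measure.isProbabilityMeasure_map (μ := P) hm.aemeasurable
  have := Measure.isProbabilityMeasure_map
    (μ := (gaussianReal 0 1).prod (gaussianReal 0 1)) hm'.aemeasurable
  refine Measure.ext_of_charFun (E := WithLp 2 (ℝ × ℝ)) (funext fun v => ?_)
  rw [charFun_apply, charFun_apply, integral_map hm.aemeasurable (by fun_prop),
    integral_map hm'.aemeasurable (by fun_prop)]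
  have h1 := h.integral_exp ![s, t] ![v.fst, v.snd]
  simp only [Fin.sum_univ_two, Matrix.cons_val_zero, Matrix.cons_val_one, hs, ht, hst] at h1
  have h2 : ∀ p : ℝ × ℝ, Complex.exp (((inner ℝ (WithLp.toLp 2
      (p.1, K s t * p.1 + √(1 - K s t ^ 2) * p.2) : WithLp 2 (ℝ × ℝ)) v : ℝ) : ℂ) * Complex.I) =
      Complex.exp (((v.fst + v.snd * K s t : ℝ) : ℂ) * (p.1 : ℂ) * Complex.I) *
        Complex.exp (((v.snd * √(1 - K s t ^ 2) : ℝ) : ℂ) * (p.2 : ℂ) * Complex.I) := by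
    intro p
    rw [← Complex.exp_add]
    congr 1
    simp only [WithLp.prod_inner_apply, real_inner_eq_re_inner]
    simp
    ring
  simp_rw [h2]
  rw [integral_prod_mul (fun x : ℝ => Complex.exp (((v.fst + v.snd * K s t : ℝ) : ℂ) *
      (x : ℂ) * Complex.I)) (fun y : ℝ => Complex.exp (((v.snd * √(1 - K s t ^ 2) : ℝ) : ℂ) *
      (y : ℂ) * Complex.I)), ← charFun_apply_real, ← charFun_apply_real,
    charFun_gaussianReal, charFun_gaussianReal, ← Complex.exp_add]
  have h3 : √(1 - K s t ^ 2) ^ 2 = 1 - K s t ^ 2 := Real.sq_sqrt (by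
    rw [sub_nonneg]
    exact (sq_le_one_iff_abs_le_one _).2 hK)
  have h4 : ∀ ω, inner ℝ (WithLp.toLp 2 (Y s ω, Y t ω) : WithLp 2 (ℝ × ℝ)) v =
      v.fst * Y s ω + v.snd * Y t ω := fun ω => by
    simp [WithLp.prod_inner_apply]
  simp_rw [h4]
  rw [h1]
  congr 1
  simp only [Complex.ofReal_zero, mul_zero, zero_mul, zero_sub, NNReal.coe_one,
    Complex.ofReal_one, one_mul]
  norm_cast
  rw [mul_pow, h3]
  ring

theorem measure_orthant [IsProbabilityMeasure P] (h : IsCentredGaussian P Y K) {s t : T}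
    (hs : K s s = 1) (ht : K t t = 1) (hst : K t s = K s t) (hK : |K s t| ≤ 1) :
    P {ω | 0 < Y s ω ∧ 0 < Y t ω} = ENNReal.ofReal (arcsinFun (K s t)) := by
  have hA : MeasurableSet {v : WithLp 2 (ℝ × ℝ) | 0 < v.fst ∧ 0 < v.snd} := by
    have : Measurable (WithLp.ofLp : WithLp 2 (ℝ × ℝ) → ℝ × ℝ) := WithLp.measurable_ofLp 2 _
    exact (measurableSet_lt measurable_const (measurable_fst.comp this)).inter
      (measurableSet_lt measurable_const (measurable_snd.comp this))
  have key := congrArg (fun μ => μ {v : WithLp 2 (ℝ × ℝ) | 0 < v.fst ∧ 0 < v.snd})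
    (h.map_pair_eq hs ht hst hK)
  have hm : Measurable fun ω => WithLp.toLp 2 (Y s ω, Y t ω) :=
    (WithLp.measurable_toLp 2 _).comp ((h.measurable s).prodMk (h.measurable t))
  have hm' : Measurable fun p : ℝ × ℝ =>
      WithLp.toLp 2 (p.1, K s t * p.1 + √(1 - K s t ^ 2) * p.2) :=
    (WithLp.measurable_toLp 2 _).comp (by fun_prop)
  rw [Measure.map_apply hm hA, Measure.map_apply hm' hA] at key
  rw [← gaussianReal_prod_orthant (abs_le.1 hK)]
  exact key

end IsCentredGaussian

/-! ### The covariance sequence -/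

/-- The Fourier coefficients of a symmetric measure. -/
noncomputable def cosCoeff (ν : Measure ℝ) (m : ℤ) : ℝ := ∫ x, Real.cos (2 * Real.pi * m * x) ∂ν

theorem cosCoeff_neg (ν : Measure ℝ) (m : ℤ) : cosCoeff ν (-m) = cosCoeff ν m := by
  refine integral_congr_ae (Eventually.of_forall fun x => ?_)
  simp only
  rw [← Real.cos_neg]
  push_cast
  ring_nf

theorem integral_odd_eq_zero (ν : Measure ℝ) [ν.IsNegInvariant] {f : ℝ → ℝ}
    (hf : ∀ x, f (-x) = -f x) :
    ∫ x, f x ∂ν = 0 := by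
  have h := integral_neg_eq_self f ν
  simp_rw [hf, integral_neg] at h
  linarith

section CosCoeff

variable (ν : Measure ℝ) [IsProbabilityMeasure ν]

theorem cosCoeff_zero : cosCoeff ν 0 = 1 := by simp [cosCoeff]

theorem abs_cosCoeff_le_one (m : ℤ) : |cosCoeff ν m| ≤ 1 := by
  have := norm_integral_le_of_norm_le_const (μ := ν) (f := fun x => Real.cos (2 * Real.pi * m * x))
    (C := 1) (Eventually.of_forall fun x => Real.abs_cos_le_one _)
  simpa [cosCoeff] using this

theorem memLp_cos_add_sin (a : ℝ) :
    MemLp (fun x => Real.cos (a * x) + Real.sin (a * x)) 2 ν := by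
  refine MemLp.of_bound (by fun_prop) 2 (Eventually.of_forall fun x => ?_)
  refine (norm_add_le _ _).trans ?_
  have h1 := Real.abs_cos_le_one (a * x)
  have h2 := Real.abs_sin_le_one (a * x)
  rw [Real.norm_eq_abs, Real.norm_eq_abs]
  linarith

/-- The vector `cos + sin` realizing the covariance sequence. -/
noncomputable def casVec (m : ℤ) : Lp ℝ 2 ν := (memLp_cos_add_sin ν (2 * Real.pi * m)).toLp _

/-- The product of two vectors `cos + sin` is `cos (a - b) + sin (a + b)`, and the sine is odd, so
symmetry of `ν` kills it. The kernel thus becomes a Gram matrix in a real Hilbert space. -/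
theorem inner_casVec [ν.IsNegInvariant] (m n : ℤ) :
    inner ℝ (casVec ν m) (casVec ν n) = cosCoeff ν (m - n) := by
  rw [L2.inner_def]
  have h : (fun x => inner ℝ (casVec ν m x) (casVec ν n x)) =ᵐ[ν]
      fun x => Real.cos (2 * Real.pi * (m - n : ℤ) * x) +
        Real.sin (2 * Real.pi * (m + n : ℤ) * x) := by
    filter_upwards [(memLp_cos_add_sin ν (2 * Real.pi * m)).coeFn_toLp,
      (memLp_cos_add_sin ν (2 * Real.pi * n)).coeFn_toLp] with x hm hn
    rw [casVec, casVec, hm, hn]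
    have e1 : 2 * Real.pi * (m - n : ℤ) * x = 2 * Real.pi * m * x - 2 * Real.pi * n * x := by
      push_cast; ring
    have e2 : 2 * Real.pi * (m + n : ℤ) * x = 2 * Real.pi * m * x + 2 * Real.pi * n * x := by
      push_cast; ring
    rw [e1, e2, Real.cos_sub, Real.sin_add]
    simp only [RCLike.inner_apply, conj_trivial]
    ring
  have hodd := integral_odd_eq_zero ν
    (f := fun x => Real.sin (2 * Real.pi * (m + n : ℤ) * x)) fun x => by
      rw [← Real.sin_neg]
      ring_nf
  rw [integral_congr_ae h, integral_add, hodd, add_zero, cosCoeff]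
  · exact (integrable_const (1 : ℝ)).mono' (by fun_prop)
      (Eventually.of_forall fun x => Real.abs_cos_le_one _)
  · exact (integrable_const (1 : ℝ)).mono' (by fun_prop)
      (Eventually.of_forall fun x => Real.abs_sin_le_one _)

theorem exists_isCentredGaussian_cosCoeff [ν.IsNegInvariant] :
    ∃ Y : ℤ → (ℕ → ℝ) → ℝ,
      IsCentredGaussian gaussianNoise Y fun m n => cosCoeff ν (m - n) := by
  -- Gram-Schmidt runs over `ℕ`, so the integers are enumerated first.
  have h := (isCentredGaussian_gaussianNoise
    fun n => casVec ν (Equiv.intEquivNat.symm n)).comp Equiv.intEquivNat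
  simp only [Equiv.symm_apply_apply, inner_casVec] at h
  exact ⟨_, h⟩

end CosCoeff

/-! ### Wiener's lemma -/

/-- Geometric sums of ratio `e^{ia} ≠ 1` are bounded independently of `N`. -/
theorem tendsto_average_cos {a : ℝ} (ha : Complex.exp (a * Complex.I) ≠ 1) (b : ℝ) :
    Tendsto (fun N : ℕ => (N : ℝ)⁻¹ * ∑ n ∈ Finset.range N, Real.cos (n * a + b)) atTop (𝓝 0) := by
  have hb : ∀ N : ℕ, |∑ n ∈ Finset.range N, Real.cos (n * a + b)| ≤
      2 / ‖Complex.exp (a * Complex.I) - 1‖ := by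
    intro N
    have h1 : ∑ n ∈ Finset.range N, Real.cos (n * a + b) =
        (Complex.exp (b * Complex.I) *
          ∑ n ∈ Finset.range N, Complex.exp (a * Complex.I) ^ n).re := by
      rw [Finset.mul_sum, Complex.re_sum]
      refine Finset.sum_congr rfl fun n _ => ?_
      rw [← Complex.exp_nat_mul, ← Complex.exp_add, ← Complex.exp_ofReal_mul_I_re]
      congr 2
      push_cast
      ring
    rw [h1, geom_sum_eq ha]
    refine (Complex.abs_re_le_norm _).trans ?_
    rw [norm_mul, Complex.norm_exp_ofReal_mul_I, one_mul, norm_div]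
    gcongr
    refine (norm_sub_le _ _).trans ?_
    rw [norm_pow, Complex.norm_exp_ofReal_mul_I]
    norm_num
  have h0 := tendsto_inv_atTop_nhds_zero_nat (𝕜 := ℝ)
  refine squeeze_zero_norm (a := fun N : ℕ => (N : ℝ)⁻¹ *
    (2 / ‖Complex.exp (a * Complex.I) - 1‖)) (fun N => ?_) (by simpa using h0.mul_const _)
  rw [norm_mul, Real.norm_of_nonneg (by positivity)]
  gcongr
  exact hb N

theorem exp_two_pi_mul_I_ne_one {x : ℝ} (hx : ∀ k : ℤ, x ≠ k) :
    Complex.exp ((2 * Real.pi * x : ℝ) * Complex.I) ≠ 1 := by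
  intro h
  obtain ⟨n, hn⟩ := Complex.exp_eq_one_iff.1 h
  refine hx n ?_
  have h2 : (2 * Real.pi * Complex.I) ≠ 0 := Complex.two_pi_I_ne_zero
  have : (x : ℂ) = n := by
    apply mul_right_cancel₀ h2
    rw [← hn]
    push_cast
    ring
  exact_mod_cast this

section Wiener

variable (ν : Measure ℝ) [IsProbabilityMeasure ν] [NullSingletonClass ν]

/-- The absence of atoms enters here: each exceptional line has one-point sections, so it is null by
Fubini. -/
theorem ae_prod_sub_add_ne_int :
    ∀ᵐ p : ℝ × ℝ ∂(ν.prod ν), ∀ k : ℤ, p.1 - p.2 ≠ (k : ℝ) ∧ p.1 + p.2 ≠ (k : ℝ) := by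
  refine ae_all_iff.2 fun k => Filter.Eventually.and ?_ ?_
  · have hs : MeasurableSet {p : ℝ × ℝ | p.1 - p.2 = k} :=
      measurableSet_eq_fun (by fun_prop) measurable_const
    rw [ae_iff]
    simp only [ne_eq, not_not]
    rw [Measure.measure_prod_null hs]
    refine Eventually.of_forall fun x => ?_
    refine measure_mono_null (t := {x - k}) (fun y hy => ?_) (measure_singleton _)
    simp only [Set.mem_preimage, Set.mem_ofPred_eq] at hy
    simp only [Set.mem_singleton_iff]
    linarith
  · have hs : MeasurableSet {p : ℝ × ℝ | p.1 + p.2 = k} :=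
      measurableSet_eq_fun (by fun_prop) measurable_const
    rw [ae_iff]
    simp only [ne_eq, not_not]
    rw [Measure.measure_prod_null hs]
    refine Eventually.of_forall fun x => ?_
    refine measure_mono_null (t := {k - x}) (fun y hy => ?_) (measure_singleton _)
    simp only [Set.mem_preimage, Set.mem_ofPred_eq] at hy
    simp only [Set.mem_singleton_iff]
    linarith

/-- **Wiener's lemma** for the translates of the Fourier coefficients of a continuous measure. -/
theorem tendsto_average_cosCoeff_sq (l : ℤ) :
    Tendsto (fun N : ℕ => (N : ℝ)⁻¹ * ∑ n ∈ Finset.range N, cosCoeff ν (n + l) ^ 2) atTop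
      (𝓝 0) := by
  set F : ℕ → ℝ × ℝ → ℝ := fun N p => (N : ℝ)⁻¹ * ∑ n ∈ Finset.range N,
    Real.cos (2 * Real.pi * (n + l : ℤ) * p.1) * Real.cos (2 * Real.pi * (n + l : ℤ) * p.2)
    with hF
  have hbd : ∀ (n : ℤ) (p : ℝ × ℝ),
      ‖Real.cos (2 * Real.pi * n * p.1) * Real.cos (2 * Real.pi * n * p.2)‖ ≤ 1 := by
    intro n p
    rw [norm_mul]
    exact mul_le_one₀ (Real.abs_cos_le_one _) (norm_nonneg _) (Real.abs_cos_le_one _)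
  -- A squared integral is a double integral, so the averages become integrals over `ν ⊗ ν`.
  have hint : ∀ N, ∫ p, F N p ∂(ν.prod ν) =
      (N : ℝ)⁻¹ * ∑ n ∈ Finset.range N, cosCoeff ν (n + l) ^ 2 := by
    intro N
    simp only [hF]
    rw [integral_const_mul, integral_finsetSum]
    · congr 1
      refine Finset.sum_congr rfl fun n _ => ?_
      rw [integral_prod_mul (fun x => Real.cos (2 * Real.pi * (n + l : ℤ) * x))
        (fun x => Real.cos (2 * Real.pi * (n + l : ℤ) * x)), sq]
      rfl
    · intro n _
      exact (integrable_const (1 : ℝ)).mono' (by fun_prop) (Eventually.of_forall fun p => hbd _ p)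
  simp_rw [← hint]
  rw [← integral_zero (ℝ × ℝ) ℝ (μ := ν.prod ν)]
  refine tendsto_integral_of_dominated_convergence (fun _ => 1) (fun N => ?_)
    (integrable_const _) (fun N => Eventually.of_forall fun p => ?_) ?_
  · exact (by fun_prop : Continuous (F N)).aestronglyMeasurable
  · simp only [hF]
    rw [norm_mul, norm_inv, Real.norm_natCast]
    refine inv_mul_le_one_of_le₀ ?_ (Nat.cast_nonneg _)
    refine (norm_sum_le _ _).trans ((Finset.sum_le_sum fun n _ => hbd _ p).trans ?_)
    simp
  -- The product of cosines splits into cosines with frequencies `x - y` and `x + y`, almost surely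
  -- not integers.
  · filter_upwards [ae_prod_sub_add_ne_int ν] with p hp
    have h1 := tendsto_average_cos (exp_two_pi_mul_I_ne_one fun k => (hp k).1)
      (2 * Real.pi * l * (p.1 - p.2))
    have h2 := tendsto_average_cos (exp_two_pi_mul_I_ne_one fun k => (hp k).2)
      (2 * Real.pi * l * (p.1 + p.2))
    have h3 := (h1.add h2).const_mul (1 / 2)
    simp only [add_zero, mul_zero] at h3
    refine h3.congr fun N => ?_
    simp only [hF]
    rw [← mul_add, ← Finset.sum_add_distrib, mul_left_comm, Finset.mul_sum]
    congr 1
    refine Finset.sum_congr rfl fun n _ => ?_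
    have e1 : (n : ℝ) * (2 * Real.pi * (p.1 - p.2)) + 2 * Real.pi * l * (p.1 - p.2) =
        2 * Real.pi * (n + l : ℤ) * p.1 - 2 * Real.pi * (n + l : ℤ) * p.2 := by
      push_cast; ring
    have e2 : (n : ℝ) * (2 * Real.pi * (p.1 + p.2)) + 2 * Real.pi * l * (p.1 + p.2) =
        2 * Real.pi * (n + l : ℤ) * p.1 + 2 * Real.pi * (n + l : ℤ) * p.2 := by
      push_cast; ring
    rw [e1, e2, Real.cos_sub, Real.cos_add]
    ring

/-- Summing Wiener averages over `l ∈ s` before choosing `n` yields one `n` good for all `l`. -/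
theorem exists_forall_cosCoeff_add_lt (s : Finset ℤ) {δ : ℝ} (hδ : 0 < δ) :
    ∃ n : ℕ, ∀ l ∈ s, |cosCoeff ν (n + l)| < δ := by
  have h : Tendsto (fun N : ℕ => ∑ l ∈ s, (N : ℝ)⁻¹ * ∑ n ∈ Finset.range N,
      cosCoeff ν (n + l) ^ 2) atTop (𝓝 (∑ l ∈ s, 0)) :=
    tendsto_finsetSum _ fun l _ => tendsto_average_cosCoeff_sq ν l
  rw [Finset.sum_const_zero] at h
  obtain ⟨N, hN, hN0⟩ := ((h.eventually_lt_const (sq_pos_of_pos hδ)).and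
    (eventually_gt_atTop 0)).exists
  have hN' : (0 : ℝ) < N := by exact_mod_cast hN0
  rw [← Finset.mul_sum, inv_mul_lt_iff₀ hN', Finset.sum_comm] at hN
  have h2 : ∑ n ∈ Finset.range N, ∑ l ∈ s, cosCoeff ν (n + l) ^ 2 <
      ∑ n ∈ Finset.range N, δ ^ 2 := by simpa using hN
  obtain ⟨n, _, hn⟩ := Finset.exists_lt_of_sum_lt h2
  refine ⟨n, fun l hl => abs_lt_of_sq_lt_sq ?_ hδ.le⟩
  exact (Finset.single_le_sum (f := fun l => cosCoeff ν (n + l) ^ 2)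
    (fun l _ => sq_nonneg _) hl).trans_lt hn

/-- Diagonal choice: `φ j` serves all `|l| ≤ j` with tolerance `1/(j+1)`. -/
theorem exists_seq_tendsto_cosCoeff_add :
    ∃ φ : ℕ → ℕ, ∀ l : ℤ, Tendsto (fun j => cosCoeff ν (φ j + l)) atTop (𝓝 0) := by
  choose φ hφ using fun j : ℕ => exists_forall_cosCoeff_add_lt ν (Finset.Icc (-(j : ℤ)) j)
    (Nat.one_div_pos_of_nat (α := ℝ) (n := j))
  refine ⟨φ, fun l => squeeze_zero_norm' ?_ (tendsto_one_div_add_atTop_nhds_zero_nat (𝕜 := ℝ))⟩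
  filter_upwards [eventually_ge_atTop l.natAbs] with j hj
  refine (hφ j l ?_).le
  rw [Finset.mem_Icc]
  omega

end Wiener

/-! ### Ergodicity from mixing along a sequence -/

/-- An invariant `s` is approximated by some `t ∈ C`; then `t ∩ T⁻ⁿ t` is close to `s`, while its
measure is close to `μ(t)²`. Hence `μ(s) = μ(s)²`. One good `n` per set and tolerance is enough. -/
theorem preErgodic_of_exists_mixing {α : Type*} [mα : MeasurableSpace α] {μ : Measure α}
    [IsProbabilityMeasure μ] {T : α → α} (hT : MeasurePreserving T μ μ) {C : Set (Set α)}
    (hC : IsSetRing C) (huniv : Set.univ ∈ C) (hgen : mα = MeasurableSpace.generateFrom C)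
    (hmix : ∀ A ∈ C, ∀ ε : ℝ, 0 < ε → ∃ n : ℕ,
      |μ.real (A ∩ T^[n] ⁻¹' A) - μ.real A * μ.real A| < ε) :
    PreErgodic T μ where
  aeconst_set s hs hinv := by
    have hmeas : ∀ A ∈ C, MeasurableSet A := fun A hA => by
      rw [hgen]
      exact MeasurableSpace.measurableSet_generateFrom hA
    have hn : ∀ n : ℕ, T^[n] ⁻¹' s = s := fun n => by
      induction n with
      | zero => rfl
      | succ n ih => rw [Function.iterate_succ, Set.preimage_comp, ih, hinv]
    -- The constant is `2 + 1 + 2`: approximating the intersection, mixing, and approximating the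
    -- square.
    have key : ∀ ε : ℝ, 0 < ε → |μ.real s - μ.real s * μ.real s| ≤ 5 * ε := by
      intro ε hε
      obtain ⟨t, ht, hts⟩ := exists_measure_symmDiff_lt_of_generateFrom_isSetRing (μ := μ) hC
        ⟨{Set.univ}, Set.countable_singleton _, by simpa using huniv, by simp⟩ hgen hs
        (ENNReal.ofReal_pos.2 hε)
      obtain ⟨n, hn'⟩ := hmix t ht ε hε
      have htm := hmeas t ht
      have hd : μ.real (symmDiff t s) < ε :=
        ENNReal.toReal_lt_of_lt_ofReal hts
      have h1 : |μ.real t - μ.real s| ≤ ε :=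
        (abs_measureReal_sub_le_measureReal_symmDiff htm.nullMeasurableSet
          hs.nullMeasurableSet).trans hd.le
      have hTn : MeasurePreserving T^[n] μ μ := hT.iterate n
      have h2 : |μ.real (t ∩ T^[n] ⁻¹' t) - μ.real s| ≤ 2 * ε := by
        refine (abs_measureReal_sub_le_measureReal_symmDiff
          (htm.inter (hTn.measurable htm)).nullMeasurableSet hs.nullMeasurableSet).trans ?_
        have hsub : symmDiff (t ∩ T^[n] ⁻¹' t) s ⊆ symmDiff t s ∪ T^[n] ⁻¹' (symmDiff t s) := by
          intro x hx
          have hxs : x ∈ s ↔ T^[n] x ∈ s := by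
            conv_lhs => rw [← hn n]
            rfl
          simp only [Set.mem_symmDiff, Set.mem_inter_iff, Set.mem_preimage, Set.mem_union] at hx ⊢
          tauto
        refine (measureReal_mono hsub).trans ((measureReal_union_le _ _).trans ?_)
        have : μ.real (T^[n] ⁻¹' symmDiff t s) = μ.real (symmDiff t s) :=
          measureReal_def μ _ ▸ measureReal_def μ _ ▸
            congrArg ENNReal.toReal (hTn.measure_preimage (htm.symmDiff hs).nullMeasurableSet)
        rw [this]
        linarith
      have h3 : |μ.real t * μ.real t - μ.real s * μ.real s| ≤ 2 * ε := by
        have e : μ.real t * μ.real t - μ.real s * μ.real s =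
          (μ.real t - μ.real s) * (μ.real t + μ.real s) := by ring
        rw [e, abs_mul, mul_comm]
        have h4 : |μ.real t + μ.real s| ≤ 2 := by
          rw [abs_of_nonneg (by positivity)]
          linarith [measureReal_le_one (μ := μ) (s := t), measureReal_le_one (μ := μ) (s := s)]
        exact mul_le_mul h4 h1 (abs_nonneg _) zero_le_two
      rw [abs_le] at h2 h3 ⊢
      rw [abs_lt] at hn'
      constructor <;> linarith
    have h0 : μ.real s - μ.real s * μ.real s = 0 := by
      by_contra hne
      have hpos := abs_pos.2 hne
      have := key _ (div_pos hpos (by norm_num : (0 : ℝ) < 10))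
      linarith
    have h01 : μ.real s = 0 ∨ μ.real s = 1 := by
      have : μ.real s * (1 - μ.real s) = 0 := by linarith
      rcases mul_eq_zero.1 this with h | h
      · exact Or.inl h
      · exact Or.inr (by linarith)
    rw [Filter.eventuallyConst_set']
    rcases h01 with h | h
    · exact Or.inl (ae_eq_empty.2 ((measureReal_eq_zero_iff).1 h))
    · right
      rw [ae_eq_univ, prob_compl_eq_zero_iff hs, ← ENNReal.toReal_eq_one_iff]
      exact h

/-! ### The signs of a Gaussian process -/

/-- Near a continuity point, a map into a discrete space is constant. -/
theorem frontier_preimage_subset {X D : Type*} [TopologicalSpace X] [TopologicalSpace D]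
    [DiscreteTopology D] (g : X → D) (S : Set D) :
    frontier (g ⁻¹' S) ⊆ {x | ¬ ContinuousAt g x} := by
  intro x hx hcont
  by_cases h : g x ∈ S
  · exact hx.2 (mem_interior_iff_mem_nhds.2 (hcont ((isOpen_discrete S).mem_nhds h)))
  · have h2 : g ⁻¹' Sᶜ ∈ 𝓝 x := hcont ((isOpen_discrete Sᶜ).mem_nhds h)
    rw [frontier_eq_closure_inter_closure] at hx
    obtain ⟨y, hy1, hy2⟩ := mem_closure_iff_nhds.1 hx.1 _ h2
    exact hy1 hy2

/-- The indicator function of the positive half-line. -/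
noncomputable def posBit (y : ℝ) : Fin 2 := if 0 < y then 1 else 0

theorem posBit_eq_one_iff {y : ℝ} : posBit y = 1 ↔ 0 < y := by
  simp [posBit]

theorem measurable_posBit : Measurable posBit :=
  Measurable.ite measurableSet_Ioi measurable_const measurable_const

theorem continuousAt_posBit {y : ℝ} (hy : y ≠ 0) : ContinuousAt posBit y := by
  rcases lt_or_gt_of_ne hy with h | h
  · refine (continuousAt_const (y := (0 : Fin 2))).congr ?_
    filter_upwards [gt_mem_nhds h] with z hz
    simp [posBit, hz.le]
  · refine (continuousAt_const (y := (1 : Fin 2))).congr ?_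
    filter_upwards [lt_mem_nhds h] with z hz
    simp [posBit, hz]

theorem measure_frontier_posBit_eq_zero {ι : Type*} [Fintype ι]
    {μ : Measure (EuclideanSpace ℝ ι)} (hμ : ∀ a, μ {v | v a = 0} = 0) (S : Set (ι → Fin 2)) :
    μ (frontier ((fun (v : EuclideanSpace ℝ ι) a => posBit (v a)) ⁻¹' S)) = 0 := by
  refine measure_mono_null (t := ⋃ a, {v : EuclideanSpace ℝ ι | v a = 0})
    (fun v hv => ?_) (measure_iUnion_null hμ)
  have hv' := frontier_preimage_subset _ _ hv
  by_contra hcon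
  simp only [Set.mem_iUnion, Set.mem_ofPred_eq, not_exists] at hcon
  refine hv' (continuousAt_pi.2 fun a => ?_)
  have h1 : Continuous fun v : EuclideanSpace ℝ ι => v a := by fun_prop
  exact ContinuousAt.comp (f := fun v : EuclideanSpace ℝ ι => v a) (continuousAt_posBit (hcon a))
    h1.continuousAt

section Mixing

variable {Ω : Type*} [MeasurableSpace Ω] {P : Measure Ω} [IsProbabilityMeasure P]
  {Y : ℤ → Ω → ℝ} {ν : Measure ℝ} [IsProbabilityMeasure ν]

/-- Lévy's continuity theorem gives convergence in law of the block and its translate to two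
independent copies. The portmanteau theorem applies to sign events because their boundary lies in
coordinate hyperplanes, which are null. -/
theorem IsCentredGaussian.tendsto_measure_inter
    (h : IsCentredGaussian P Y fun m n => cosCoeff ν (m - n)) {φ : ℕ → ℕ}
    (hφ : ∀ l : ℤ, Tendsto (fun j => cosCoeff ν (φ j + l)) atTop (𝓝 0)) (I : Finset ℤ)
    (S : Set (I → Fin 2)) :
    Tendsto (fun j => P {ω | (fun i : I => posBit (Y i ω)) ∈ S ∧
        (fun i : I => posBit (Y (i + φ j) ω)) ∈ S}) atTop
      (𝓝 (P {ω | (fun i : I => posBit (Y i ω)) ∈ S} *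
        P {ω | (fun i : I => posBit (Y i ω)) ∈ S})) := by
  set n : ℕ → I ⊕ I → ℤ := fun j => Sum.elim (fun i => (i : ℤ)) fun i => i + φ j with hn
  set Z : I ⊕ I → Ω × Ω → ℝ := fun a q => Sum.elim (fun i : I => Y i q.1) (fun i : I => Y i q.2) a
    with hZ
  have hYm : ∀ j, Measurable fun ω => WithLp.toLp 2 fun a => Y (n j a) ω :=
    fun j => measurable_toLp_of_forall fun a => h.measurable _
  have hZc : ∀ a, Measurable (Z a) := by
    rintro (i | i)
    · exact (h.measurable i).comp measurable_fst
    · exact (h.measurable i).comp measurable_snd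
  have hZm : Measurable fun q => WithLp.toLp 2 fun a => Z a q := measurable_toLp_of_forall hZc
  let μ : ℕ → ProbabilityMeasure (EuclideanSpace ℝ (I ⊕ I)) := fun j =>
    ⟨P.map fun ω => WithLp.toLp 2 fun a => Y (n j a) ω,
      Measure.isProbabilityMeasure_map (hYm j).aemeasurable⟩
  let μ₀ : ProbabilityMeasure (EuclideanSpace ℝ (I ⊕ I)) :=
    ⟨(P.prod P).map fun q => WithLp.toLp 2 fun a => Z a q,
      Measure.isProbabilityMeasure_map hZm.aemeasurable⟩
  have hlim : Tendsto μ atTop (𝓝 μ₀) := by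
    refine ProbabilityMeasure.tendsto_of_tendsto_charFun fun s => ?_
    have h1 : ∀ j, charFun (μ j : Measure (EuclideanSpace ℝ (I ⊕ I))) s =
        Complex.exp (((-(∑ a, ∑ b, s a * s b * cosCoeff ν (n j a - n j b)) / 2 : ℝ) : ℂ)) :=
      fun j => h.charFun_eq _ (n j) s
    have h2 : charFun (μ₀ : Measure (EuclideanSpace ℝ (I ⊕ I))) s =
        Complex.exp (((-((∑ a : I, ∑ b : I, s (.inl a) * s (.inl b) * cosCoeff ν (a - b)) +
          ∑ a : I, ∑ b : I, s (.inr a) * s (.inr b) * cosCoeff ν (a - b)) / 2 : ℝ) : ℂ)) := by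
      change charFun ((P.prod P).map fun q => WithLp.toLp 2 fun a => Z a q) s = _
      rw [charFun_apply, integral_map hZm.aemeasurable (by fun_prop)]
      have e : ∀ q : Ω × Ω, Complex.exp (((inner ℝ
          (WithLp.toLp 2 fun a => Z a q : EuclideanSpace ℝ (I ⊕ I)) s : ℝ) : ℂ) * Complex.I) =
          Complex.exp (((∑ a : I, s (.inl a) * Y a q.1 : ℝ) : ℂ) * Complex.I) *
            Complex.exp (((∑ a : I, s (.inr a) * Y a q.2 : ℝ) : ℂ) * Complex.I) := by
        intro q
        rw [← Complex.exp_add, ← add_mul, ← Complex.ofReal_add]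
        congr 3
        simp [PiLp.inner_apply, hZ]
      simp_rw [e]
      rw [integral_prod_mul
        (fun ω => Complex.exp (((∑ a : I, s (.inl a) * Y a ω : ℝ) : ℂ) * Complex.I))
        (fun ω => Complex.exp (((∑ a : I, s (.inr a) * Y a ω : ℝ) : ℂ) * Complex.I)),
        h.integral_exp (fun a : I => (a : ℤ)), h.integral_exp (fun a : I => (a : ℤ)),
        ← Complex.exp_add]
      congr 1
      push_cast
      ring
    simp_rw [h1, h2]
    refine (Complex.continuous_exp.tendsto _).comp ?_
    refine (Complex.continuous_ofReal.tendsto _).comp ?_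
    refine Tendsto.div_const (Tendsto.neg ?_) 2
    -- The diagonal covariance blocks do not depend on `j`, since the shift cancels; the
    -- off-diagonal ones tend to zero.
    simp_rw [Fintype.sum_sum_type, hn, Sum.elim_inl, Sum.elim_inr, add_sub_add_right_eq_sub,
      Finset.sum_add_distrib]
    have hc1 : ∀ a b : ℤ, Tendsto (fun j => cosCoeff ν (a - (b + φ j))) atTop (𝓝 0) := by
      intro a b
      refine (hφ (b - a)).congr fun j => ?_
      rw [← cosCoeff_neg]
      congr 1
      ring
    have hc2 : ∀ a b : ℤ, Tendsto (fun j => cosCoeff ν (a + φ j - b)) atTop (𝓝 0) := by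
      intro a b
      refine (hφ (a - b)).congr fun j => ?_
      congr 1
      ring
    have l1 : Tendsto (fun j => ∑ a : I, ∑ b : I, s (.inl a) * s (.inr b) *
        cosCoeff ν (a - (b + φ j))) atTop (𝓝 0) := by
      have := tendsto_finsetSum Finset.univ fun (a : I) _ =>
        tendsto_finsetSum Finset.univ fun (b : I) _ =>
          (hc1 a b).const_mul (s (.inl a) * s (.inr b))
      simpa using this
    have l2 : Tendsto (fun j => ∑ a : I, ∑ b : I, s (.inr a) * s (.inl b) *
        cosCoeff ν (a + φ j - b)) atTop (𝓝 0) := by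
      have := tendsto_finsetSum Finset.univ fun (a : I) _ =>
        tendsto_finsetSum Finset.univ fun (b : I) _ =>
          (hc2 a b).const_mul (s (.inr a) * s (.inl b))
      simpa using this
    have := ((tendsto_const_nhds (x := ∑ a : I, ∑ b : I, s (.inl a) * s (.inl b) *
      cosCoeff ν (a - b))).add l1).add (l2.add (tendsto_const_nhds (x := ∑ a : I, ∑ b : I,
      s (.inr a) * s (.inr b) * cosCoeff ν (a - b))))
    simp only [add_zero, zero_add] at this
    exact this
  set E : Set (EuclideanSpace ℝ (I ⊕ I)) :=
    (fun (v : EuclideanSpace ℝ (I ⊕ I)) a => posBit (v a)) ⁻¹'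
      {x | (fun i => x (.inl i)) ∈ S ∧ (fun i => x (.inr i)) ∈ S} with hE
  have hEm : MeasurableSet E := by
    have : Measurable fun (v : EuclideanSpace ℝ (I ⊕ I)) a => posBit (v a) :=
      measurable_pi_lambda _ fun a => measurable_posBit.comp (by fun_prop)
    exact this (Set.toFinite _).measurableSet
  have hnull : (μ₀ : Measure (EuclideanSpace ℝ (I ⊕ I))) (frontier E) = 0 := by
    refine measure_frontier_posBit_eq_zero (fun a => ?_) _
    change ((P.prod P).map fun q => WithLp.toLp 2 fun a => Z a q) _ = 0
    rw [Measure.map_apply hZm (measurableSet_eq_fun (by fun_prop) measurable_const)]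
    have hz : ∀ i : ℤ, P {ω | Y i ω = 0} = 0 := fun i =>
      h.measure_eq_zero (by rw [sub_self, cosCoeff_zero])
    rcases a with i | i
    · change P.prod P ((fun q : Ω × Ω => q.1) ⁻¹' {ω | Y i ω = 0}) = 0
      exact Measure.quasiMeasurePreserving_fst.preimage_null (hz i)
    · change P.prod P ((fun q : Ω × Ω => q.2) ⁻¹' {ω | Y i ω = 0}) = 0
      exact Measure.quasiMeasurePreserving_snd.preimage_null (hz i)
  have hfin := ProbabilityMeasure.tendsto_measure_of_null_frontier_of_tendsto' hlim hnull
  have e0 : (μ₀ : Measure (EuclideanSpace ℝ (I ⊕ I))) E =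
      P {ω | (fun i : I => posBit (Y i ω)) ∈ S} * P {ω | (fun i : I => posBit (Y i ω)) ∈ S} := by
    change ((P.prod P).map fun q => WithLp.toLp 2 fun a => Z a q) E = _
    rw [Measure.map_apply hZm hEm, ← Measure.prod_prod]
    rfl
  rw [e0] at hfin
  refine hfin.congr fun j => ?_
  change (P.map fun ω => WithLp.toLp 2 fun a => Y (n j a) ω) E = _
  rw [Measure.map_apply (hYm j) hEm]
  rfl

end Mixing

/-! ### The binary process and its pair averages -/

/-- The left shift of two-sided binary sequences. -/
def binaryShift (x : ℤ → Fin 2) (k : ℤ) : Fin 2 := x (k + 1)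

theorem measurable_binaryShift : Measurable binaryShift :=
  measurable_pi_lambda _ fun _ => measurable_pi_apply _

theorem iterate_binaryShift (n : ℕ) (x : ℤ → Fin 2) (k : ℤ) :
    binaryShift^[n] x k = x (k + n) := by
  induction n generalizing x with
  | zero => simp
  | succ n ih =>
    rw [Function.iterate_succ_apply, ih, binaryShift]
    congr 1
    push_cast
    ring

/-- The indicator of the event that both `j` and `j + m` are occupied. -/
def pairBit (x : ℤ → Fin 2) (m j : ℤ) : ℝ := if x j = 1 ∧ x (j + m) = 1 then 1 else 0

theorem pairBit_nonneg (x : ℤ → Fin 2) (m j : ℤ) : 0 ≤ pairBit x m j := by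
  unfold pairBit
  split_ifs <;> norm_num

theorem pairBit_le_one (x : ℤ → Fin 2) (m j : ℤ) : pairBit x m j ≤ 1 := by
  unfold pairBit
  split_ifs <;> norm_num

theorem measurableSet_pair_eq_one (m : ℤ) :
    MeasurableSet {x : ℤ → Fin 2 | x 0 = 1 ∧ x m = 1} :=
  (measurable_pi_apply 0 (measurableSet_singleton 1)).inter
    (measurable_pi_apply m (measurableSet_singleton 1))

theorem measurable_pairBit_zero (m : ℤ) : Measurable fun x => pairBit x m 0 := by
  simp only [pairBit, zero_add]
  exact Measurable.ite (measurableSet_pair_eq_one m) measurable_const measurable_const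

section BinaryProcess

variable {Ω : Type*} [MeasurableSpace Ω] {P : Measure Ω} {Y : ℤ → Ω → ℝ} {ν : Measure ℝ}

theorem IsCentredGaussian.measurable_posBit
    (h : IsCentredGaussian P Y fun m n => cosCoeff ν (m - n))
    (f : ℤ → ℤ) : Measurable fun ω k => posBit (Y (f k) ω) :=
  measurable_pi_lambda _ fun k => _root_.measurable_posBit.comp (h.measurable (f k))

/-- Used with `k ↦ k + 1` for stationarity and with `k ↦ -k` for time reversal. -/
theorem IsCentredGaussian.map_posBit_comp [IsProbabilityMeasure P]
    (h : IsCentredGaussian P Y fun m n => cosCoeff ν (m - n)) {f : ℤ → ℤ}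
    (hf : ∀ m n, cosCoeff ν (f m - f n) = cosCoeff ν (m - n)) :
    (P.map fun ω k => posBit (Y (f k) ω)) = P.map fun ω k => posBit (Y k ω) := by
  have h2 : IsCentredGaussian P (fun k => Y (f k)) fun m n => cosCoeff ν (m - n) := by
    simpa only [hf] using h.comp f
  have hm : Measurable fun (y : ℤ → ℝ) k => posBit (y k) :=
    measurable_pi_lambda _ fun k => _root_.measurable_posBit.comp (measurable_pi_apply k)
  have key := congrArg (Measure.map fun (y : ℤ → ℝ) k => posBit (y k)) (h2.map_eq h)
  rw [Measure.map_map hm (measurable_pi_lambda _ h2.measurable),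
    Measure.map_map hm (measurable_pi_lambda _ h.measurable)] at key
  exact key

variable [IsProbabilityMeasure P] [IsProbabilityMeasure ν]

/-- Cylinders form a ring generating the product σ-algebra, and mixing along `φ` is known on them.
-/
theorem IsCentredGaussian.ergodic_binaryShift [NullSingletonClass ν]
    (h : IsCentredGaussian P Y fun m n => cosCoeff ν (m - n)) :
    Ergodic binaryShift (P.map fun ω k => posBit (Y k ω)) := by
  have hm : Measurable fun ω k => posBit (Y k ω) := h.measurable_posBit id
  have := Measure.isProbabilityMeasure_map (μ := P) hm.aemeasurable
  have hmp : MeasurePreserving binaryShift (P.map fun ω k => posBit (Y k ω))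
      (P.map fun ω k => posBit (Y k ω)) := by
    refine ⟨measurable_binaryShift, ?_⟩
    rw [Measure.map_map measurable_binaryShift hm]
    exact h.map_posBit_comp (f := fun k => k + 1) fun m n => by rw [add_sub_add_right_eq_sub]
  obtain ⟨φ, hφ⟩ := exists_seq_tendsto_cosCoeff_add ν
  refine ⟨hmp, preErgodic_of_exists_mixing hmp (C := measurableCylinders fun _ : ℤ => Fin 2)
    isSetRing_measurableCylinders (univ_mem_measurableCylinders _)
    generateFrom_measurableCylinders.symm fun A hA ε hε => ?_⟩
  obtain ⟨I, S, hS, rfl⟩ := (mem_measurableCylinders A).1 hA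
  have hAm : MeasurableSet (cylinder (α := fun _ : ℤ => Fin 2) I S) := hS.cylinder I
  have ht := h.tendsto_measure_inter hφ I S
  have ht2 := (ENNReal.tendsto_toReal
    (ENNReal.mul_ne_top (measure_ne_top _ _) (measure_ne_top _ _))).comp ht
  rw [ENNReal.toReal_mul] at ht2
  obtain ⟨j, hj⟩ := (Metric.tendsto_nhds.1 ht2 ε hε).exists
  refine ⟨φ j, ?_⟩
  rw [Real.dist_eq] at hj
  have e1 : (fun ω k => posBit (Y k ω)) ⁻¹' (cylinder (α := fun _ : ℤ => Fin 2) I S ∩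
      binaryShift^[φ j] ⁻¹' cylinder I S) = {ω | (fun i : I => posBit (Y i ω)) ∈ S ∧
        (fun i : I => posBit (Y (i + φ j) ω)) ∈ S} := by
    ext ω
    refine and_congr Iff.rfl ?_
    have : Finset.restrict I (binaryShift^[φ j] fun k => posBit (Y k ω)) =
        fun i : I => posBit (Y (i + φ j) ω) := by
      ext i
      simp [Finset.restrict, iterate_binaryShift]
    rw [Set.mem_preimage, mem_cylinder, this]
  rw [measureReal_def, measureReal_def, Measure.map_apply hm hAm, Measure.map_apply hm
    (hAm.inter ((hmp.iterate (φ j)).measurable hAm)), e1]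
  exact hj

theorem IsCentredGaussian.integral_pairBit [NullSingletonClass ν]
    (h : IsCentredGaussian P Y fun m n => cosCoeff ν (m - n)) (m : ℤ) :
    ∫ x, pairBit x m 0 ∂(P.map fun ω k => posBit (Y k ω)) = arcsinFun (cosCoeff ν m) := by
  have hm : Measurable fun ω k => posBit (Y k ω) := h.measurable_posBit id
  have e : (fun x => pairBit x m 0) = Set.indicator {x : ℤ → Fin 2 | x 0 = 1 ∧ x m = 1} 1 := by
    ext x
    simp [pairBit, Set.indicator_apply]
  rw [e, integral_indicator_one (measurableSet_pair_eq_one m), measureReal_def,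
    Measure.map_apply hm (measurableSet_pair_eq_one m)]
  have e2 : (fun ω k => posBit (Y k ω)) ⁻¹' {x : ℤ → Fin 2 | x 0 = 1 ∧ x m = 1} =
      {ω | 0 < Y m ω ∧ 0 < Y 0 ω} := by
    ext ω
    simp [posBit_eq_one_iff, and_comm]
  have hz : ∀ k : ℤ, cosCoeff ν (k - k) = 1 := fun k => by rw [sub_self, cosCoeff_zero]
  rw [e2, h.measure_orthant (hz m) (hz 0) (by rw [← cosCoeff_neg, neg_sub])
    (abs_cosCoeff_le_one ν _), sub_zero,
    ENNReal.toReal_ofReal (arcsinFun_nonneg _)]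

theorem IsCentredGaussian.ae_tendsto_average_pairBit [NullSingletonClass ν]
    (h : IsCentredGaussian P Y fun m n => cosCoeff ν (m - n)) {f : ℤ → ℤ}
    (hf : ∀ m n, cosCoeff ν (f m - f n) = cosCoeff ν (m - n)) (m : ℤ) :
    ∀ᵐ ω ∂P, Tendsto (fun N : ℕ => (N : ℝ)⁻¹ *
      ∑ j ∈ Finset.range N, pairBit (fun k => posBit (Y (f k) ω)) m j) atTop
      (𝓝 (arcsinFun (cosCoeff ν m))) := by
  have hm : Measurable fun ω k => posBit (Y (f k) ω) := h.measurable_posBit f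
  have := Measure.isProbabilityMeasure_map (μ := P) hm.aemeasurable
  have herg := h.ergodic_binaryShift
  rw [← h.map_posBit_comp hf] at herg
  have hint : Integrable (fun x => pairBit x m 0) (P.map fun ω k => posBit (Y (f k) ω)) := by
    refine (integrable_const (1 : ℝ)).mono' (measurable_pairBit_zero m).aestronglyMeasurable
      (Eventually.of_forall fun x => ?_)
    rw [Real.norm_of_nonneg (pairBit_nonneg _ _ _)]
    exact pairBit_le_one _ _ _
  have key := ae_of_ae_map hm.aemeasurable
    (ae_tendsto_birkhoffAverage herg (measurable_pairBit_zero m) hint)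
  rw [h.map_posBit_comp hf, h.integral_pairBit m] at key
  filter_upwards [key] with ω hω
  refine hω.congr fun N => ?_
  simp only [birkhoffAverage, birkhoffSum, smul_eq_mul]
  congr 1
  refine Finset.sum_congr rfl fun j _ => ?_
  simp only [pairBit, iterate_binaryShift, zero_add]
  rw [add_comm m]

theorem pairBit_neg (x : ℤ → Fin 2) (m j : ℤ) :
    pairBit (fun k => x (-k)) (-m) j = pairBit x m (-j) := by
  simp only [pairBit, neg_add, neg_neg]

theorem IsCentredGaussian.ae_tendsto_averages [NullSingletonClass ν]
    (h : IsCentredGaussian P Y fun m n => cosCoeff ν (m - n)) :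
    ∀ᵐ ω ∂P, ∀ m : ℤ,
      Tendsto (fun N : ℕ => (N : ℝ)⁻¹ * ∑ j ∈ Finset.range N,
        pairBit (fun k => posBit (Y k ω)) m j) atTop (𝓝 (arcsinFun (cosCoeff ν m))) ∧
      Tendsto (fun N : ℕ => (N : ℝ)⁻¹ * ∑ j ∈ Finset.range N,
        pairBit (fun k => posBit (Y k ω)) m (-j)) atTop (𝓝 (arcsinFun (cosCoeff ν m))) := by
  refine ae_all_iff.2 fun m => ?_
  have h1 := h.ae_tendsto_average_pairBit (f := id) (fun _ _ => rfl) m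
  -- Averages over negative sites are forward averages of the reversed process at lag `-m`; evenness
  -- of the covariance gives the same limit.
  have h2 := h.ae_tendsto_average_pairBit (f := fun k => -k)
    (fun a b => by rw [← cosCoeff_neg]; congr 1; ring) (-m)
  filter_upwards [h1, h2] with ω hω1 hω2
  refine ⟨hω1, ?_⟩
  rw [cosCoeff_neg] at hω2
  simpa only [fun j => pairBit_neg (fun k => posBit (Y k ω)) m j] using hω2

end BinaryProcess

/-! ### Pair counts in a window -/

theorem tendsto_two_sided_average {b : ℤ → ℝ} {c : ℝ}
    (h1 : Tendsto (fun N : ℕ => (N : ℝ)⁻¹ * ∑ j ∈ Finset.range N, b j) atTop (𝓝 c))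
    (h2 : Tendsto (fun N : ℕ => (N : ℝ)⁻¹ * ∑ j ∈ Finset.range N, b (-j)) atTop (𝓝 c)) :
    Tendsto (fun N : ℕ => (N : ℝ)⁻¹ * ∑ j ∈ Finset.Ioo (-N : ℤ) N, b j) atTop (𝓝 (2 * c)) := by
  -- Site `0` belongs to both halves and is subtracted once; for `N = 0` the identity would fail.
  have hsum : ∀ N : ℕ, 0 < N → ∑ j ∈ Finset.Ioo (-N : ℤ) N, b j =
      ∑ j ∈ Finset.range N, b j + ∑ j ∈ Finset.range N, b (-j) - b 0 := by
    intro N hN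
    induction N, hN using Nat.le_induction with
    | base =>
      have : Finset.Ioo (-(1 : ℕ) : ℤ) (1 : ℕ) = {0} := by
        ext k
        simp only [Finset.mem_Ioo, Finset.mem_singleton]
        omega
      rw [this]
      simp
    | succ N hN ih =>
      have : Finset.Ioo (-(N + 1 : ℕ) : ℤ) (N + 1 : ℕ) =
          insert (N : ℤ) (insert (-N : ℤ) (Finset.Ioo (-N : ℤ) N)) := by
        ext k
        simp only [Finset.mem_Ioo, Finset.mem_insert]
        omega
      rw [this, Finset.sum_insert (by simp; omega), Finset.sum_insert (by simp), ih,
        Finset.sum_range_succ, Finset.sum_range_succ]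
      ring
  have h3 := (h1.add h2).sub ((tendsto_inv_atTop_nhds_zero_nat (𝕜 := ℝ)).mul_const (b 0))
  rw [zero_mul, sub_zero, ← two_mul] at h3
  refine h3.congr' ?_
  filter_upwards [eventually_gt_atTop 0] with N hN
  rw [hsum N hN]
  ring

/-- The occupied sites in the window `(-N, N)`. -/
noncomputable def occupied (x : ℤ → Fin 2) (N : ℕ) : Finset ℤ :=
  {j ∈ Finset.Ioo (-N : ℤ) N | x j = 1}

theorem mem_occupied {x : ℤ → Fin 2} {N : ℕ} {j : ℤ} :
    j ∈ occupied x N ↔ (-N < j ∧ j < N) ∧ x j = 1 := by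
  simp [occupied]

/-- Edge effect: only sites within `|m|` of an end of the window can have `j + m` outside it, so the
error does not grow with `N`. -/
theorem abs_sum_pairBit_sub_card_le (x : ℤ → Fin 2) (m : ℤ) (N : ℕ) :
    |∑ j ∈ Finset.Ioo (-N : ℤ) N, pairBit x m j -
      (({j ∈ occupied x N | j + m ∈ occupied x N}.card : ℕ) : ℝ)| ≤ 2 * m.natAbs := by
  have h1 : (({j ∈ occupied x N | j + m ∈ occupied x N}.card : ℕ) : ℝ) =
      ∑ j ∈ Finset.Ioo (-N : ℤ) N, if -N < j + m ∧ j + m < N then pairBit x m j else 0 := by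
    rw [Finset.card_filter, Nat.cast_sum, occupied, Finset.sum_filter]
    refine Finset.sum_congr rfl fun j _ => ?_
    simp only [Finset.mem_filter, Finset.mem_Ioo, pairBit]
    by_cases h1 : x j = 1 <;> by_cases h2 : x (j + m) = 1 <;>
      by_cases h3 : -N < j + m ∧ j + m < N <;> simp [h1, h2, h3]
  rw [h1, ← Finset.sum_sub_distrib]
  have h2 : ∀ j ∈ Finset.Ioo (-N : ℤ) N, |pairBit x m j -
      (if -N < j + m ∧ j + m < N then pairBit x m j else 0)| ≤
      if ¬ (-N < j + m ∧ j + m < N) then 1 else 0 := by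
    intro j _
    split_ifs
    · simp
    · rw [sub_zero, abs_of_nonneg (pairBit_nonneg _ _ _)]
      exact pairBit_le_one _ _ _
  refine (Finset.abs_sum_le_sum_abs _ _).trans ((Finset.sum_le_sum h2).trans ?_)
  rw [← Finset.sum_filter, Finset.sum_const, nsmul_one]
  have hsub : ({j ∈ Finset.Ioo (-N : ℤ) N | ¬ (-N < j + m ∧ j + m < N)}) ⊆
      Finset.Ico (N - m.natAbs : ℤ) N ∪ Finset.Ioc (-N : ℤ) (-N + m.natAbs) := by
    intro j hj
    simp only [Finset.mem_filter, Finset.mem_Ioo, Finset.mem_union, Finset.mem_Ico,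
      Finset.mem_Ioc] at hj ⊢
    omega
  have := (Finset.card_le_card hsub).trans (Finset.card_union_le _ _)
  rw [Int.card_Ico, Int.card_Ioc] at this
  have h3 : (({j ∈ Finset.Ioo (-N : ℤ) N | ¬ (-N < j + m ∧ j + m < N)}).card) ≤
    2 * m.natAbs := by omega
  exact_mod_cast h3

theorem tendsto_pair_density {x : ℤ → Fin 2} {m : ℤ} {c : ℝ}
    (h1 : Tendsto (fun N : ℕ => (N : ℝ)⁻¹ * ∑ j ∈ Finset.range N, pairBit x m j) atTop (𝓝 c))
    (h2 : Tendsto (fun N : ℕ => (N : ℝ)⁻¹ * ∑ j ∈ Finset.range N, pairBit x m (-j)) atTop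
      (𝓝 c)) :
    Tendsto (fun N : ℕ => (2 * N : ℝ)⁻¹ *
      (({j ∈ occupied x N | j + m ∈ occupied x N}.card : ℕ) : ℝ)) atTop (𝓝 c) := by
  have h3 := (tendsto_two_sided_average h1 h2).const_mul (2⁻¹ : ℝ)
  rw [inv_mul_cancel_left₀ two_ne_zero] at h3
  have h4 : Tendsto (fun N : ℕ => (2 * N : ℝ)⁻¹ * (∑ j ∈ Finset.Ioo (-N : ℤ) N, pairBit x m j -
      (({j ∈ occupied x N | j + m ∈ occupied x N}.card : ℕ) : ℝ))) atTop (𝓝 0) := by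
    have h5 := (tendsto_inv_atTop_nhds_zero_nat (𝕜 := ℝ)).mul_const (m.natAbs : ℝ)
    rw [zero_mul] at h5
    refine squeeze_zero_norm (fun N => ?_) h5
    rw [norm_mul, Real.norm_of_nonneg (by positivity), Real.norm_eq_abs]
    refine (mul_le_mul_of_nonneg_left (abs_sum_pairBit_sub_card_le x m N)
      (by positivity)).trans (le_of_eq ?_)
    rw [mul_inv]
    ring
  have h6 := h3.sub h4
  rw [sub_zero] at h6
  refine h6.congr fun N => ?_
  rw [mul_inv]
  ring

/-! ### The autocorrelation of a binary sequence -/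

/-- The inclusion of the integers into the line. -/
def intEmbedding : ℤ ↪ ℝ := ⟨Int.cast, Int.cast_injective⟩

theorem intEmbedding_apply (k : ℤ) : intEmbedding k = (k : ℝ) := rfl

theorem LocallyFiniteSet.carrier_inter_ball {χ : LocallyFiniteSet} {x : ℤ → Fin 2}
    (hχ : χ.carrier = {t : ℝ | ∃ k : ℤ, x k = 1 ∧ t = (k : ℝ)}) {R : ℝ} (t : ℝ) :
    t ∈ χ.carrier ∩ Metric.ball 0 R ↔
      t ∈ (occupied x ⌈R⌉₊).map intEmbedding := by
  rw [hχ]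
  simp only [Set.mem_inter_iff, Set.mem_ofPred_eq, Metric.mem_ball, dist_zero_right,
    Real.norm_eq_abs, Finset.mem_map, mem_occupied, intEmbedding_apply]
  -- For integers, `|k| < R` and `|k| < ⌈R⌉` are equivalent.
  have key : ∀ k : ℤ, |(k : ℝ)| < R ↔ -(⌈R⌉₊ : ℤ) < k ∧ k < (⌈R⌉₊ : ℤ) := by
    intro k
    have e : |(k : ℝ)| = (k.natAbs : ℝ) := by
      rw [Nat.cast_natAbs, Int.cast_abs]
    rw [e, ← Nat.lt_ceil]
    omega
  constructor
  · rintro ⟨⟨k, hk, rfl⟩, h2⟩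
    exact ⟨k, ⟨(key k).1 h2, hk⟩, rfl⟩
  · rintro ⟨k, ⟨h1, hk⟩, rfl⟩
    exact ⟨⟨k, hk, rfl⟩, (key k).2 h1⟩

/-- Pairs are grouped by their difference `m = j - i`. -/
theorem sum_occupied_sub_eq (x : ℤ → Fin 2) (N : ℕ) {g : ℝ → ℝ} {M : ℕ}
    (hg : ∀ m : ℤ, m ∉ Finset.Icc (-M : ℤ) M → g m = 0) :
    ∑ i ∈ occupied x N, ∑ j ∈ occupied x N, g ((j : ℝ) - i) =
      ∑ m ∈ Finset.Icc (-M : ℤ) M,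
        g m * (({j ∈ occupied x N | j + m ∈ occupied x N}.card : ℕ) : ℝ) := by
  have h1 : ∀ i j : ℤ, g ((j : ℝ) - i) =
      ∑ m ∈ Finset.Icc (-M : ℤ) M, if i + m = j then g m else 0 := by
    intro i j
    have e : ∀ m : ℤ, i + m = j ↔ m = j - i := fun m => by omega
    simp_rw [e, Finset.sum_ite_eq']
    split_ifs with h
    · push_cast; rfl
    · rw [← hg _ h]; push_cast; rfl
  simp_rw [h1]
  have h2 : ∀ i, ∑ j ∈ occupied x N, ∑ m ∈ Finset.Icc (-M : ℤ) M, (if i + m = j then g m else 0) =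
      ∑ m ∈ Finset.Icc (-M : ℤ) M, if i + m ∈ occupied x N then g m else 0 := by
    intro i
    rw [Finset.sum_comm]
    exact Finset.sum_congr rfl fun m _ => Finset.sum_ite_eq _ _ _
  simp_rw [h2]
  rw [Finset.sum_comm]
  refine Finset.sum_congr rfl fun m _ => ?_
  rw [← Finset.sum_filter, Finset.sum_const, nsmul_eq_mul, mul_comm]

theorem integral_autocorrelationAt {χ : LocallyFiniteSet} {x : ℤ → Fin 2}
    (hχ : χ.carrier = {t : ℝ | ∃ k : ℤ, x k = 1 ∧ t = (k : ℝ)}) {R : ℝ} (hR : 0 < R)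
    (g : ℝ → ℝ) :
    ∫ t, g t ∂(autocorrelationAt χ R) =
      (2 * R)⁻¹ * ∑ i ∈ occupied x ⌈R⌉₊, ∑ j ∈ occupied x ⌈R⌉₊, g ((j : ℝ) - i) := by
  have hmem := LocallyFiniteSet.carrier_inter_ball hχ (R := R)
  have hfin : Finite ↥(χ.carrier ∩ Metric.ball 0 R) :=
    Set.Finite.to_subtype (((occupied x ⌈R⌉₊).map intEmbedding).finite_toSet.subset
      fun t ht => (hmem t).1 ht)
  have := Fintype.ofFinite ↥(χ.carrier ∩ Metric.ball 0 R)
  rw [autocorrelationAt, integral_smul_measure, Measure.sum_fintype, integral_finsetSum_measure]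
  · simp_rw [integral_dirac]
    rw [Fintype.sum_prod_type, Real.volume_ball, ENNReal.toReal_inv,
      ENNReal.toReal_ofReal (by positivity), smul_eq_mul]
    congr 1
    have hsub : ∀ f : ℝ → ℝ, ∑ t : ↥(χ.carrier ∩ Metric.ball 0 R), f t =
        ∑ i ∈ occupied x ⌈R⌉₊, f i := by
      intro f
      rw [← Finset.sum_subtype ((occupied x ⌈R⌉₊).map intEmbedding)
        (fun t => (hmem t).symm) f, Finset.sum_map]
      rfl
    rw [hsub fun s => ∑ t : ↥(χ.carrier ∩ Metric.ball 0 R), g ((t : ℝ) - s)]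
    exact Finset.sum_congr rfl fun i _ => hsub fun t => g (t - i)
  · intro p _
    exact integrable_dirac (by simp [enorm_lt_top])

/-- The measure `∑ c_m δ_m` on the integers. -/
noncomputable def latticeMeasure (c : ℤ → ℝ) : Measure ℝ :=
  Measure.sum fun m : ℤ => ENNReal.ofReal (c m) • Measure.dirac (m : ℝ)

theorem tendsto_integral_autocorrelationAt {χ : LocallyFiniteSet} {x : ℤ → Fin 2}
    (hχ : χ.carrier = {t : ℝ | ∃ k : ℤ, x k = 1 ∧ t = (k : ℝ)}) {c : ℤ → ℝ}
    (h1 : ∀ m, Tendsto (fun N : ℕ => (N : ℝ)⁻¹ * ∑ j ∈ Finset.range N, pairBit x m j) atTop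
      (𝓝 (c m)))
    (h2 : ∀ m, Tendsto (fun N : ℕ => (N : ℝ)⁻¹ * ∑ j ∈ Finset.range N, pairBit x m (-j)) atTop
      (𝓝 (c m))) {g : ℝ → ℝ} {M : ℕ} (hg : ∀ m : ℤ, m ∉ Finset.Icc (-M : ℤ) M → g m = 0) :
    Tendsto (fun R : ℝ => ∫ t, g t ∂(autocorrelationAt χ R)) atTop
      (𝓝 (∑ m ∈ Finset.Icc (-M : ℤ) M, g m * c m)) := by
  have hN : Tendsto (fun N : ℕ => ∑ m ∈ Finset.Icc (-M : ℤ) M, g m * ((2 * N : ℝ)⁻¹ *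
      (({j ∈ occupied x N | j + m ∈ occupied x N}.card : ℕ) : ℝ))) atTop
      (𝓝 (∑ m ∈ Finset.Icc (-M : ℤ) M, g m * c m)) :=
    tendsto_finsetSum _ fun m _ => (tendsto_pair_density (h1 m) (h2 m)).const_mul _
  -- The window has half-length `⌈R⌉` but the normalization is `2R`; the ratio tends to `1`.
  have hceil : Tendsto (fun R : ℝ => (⌈R⌉₊ : ℝ) / R) atTop (𝓝 1) := tendsto_nat_ceil_div_atTop
  have h3 := hceil.mul (hN.comp (tendsto_nat_ceil_atTop (α := ℝ)))
  rw [one_mul] at h3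
  refine h3.congr' ?_
  filter_upwards [eventually_gt_atTop 0] with R hR
  rw [integral_autocorrelationAt hχ hR, sum_occupied_sub_eq x _ hg]
  simp only [Function.comp_apply]
  have hc : (⌈R⌉₊ : ℝ) ≠ 0 := by
    have := Nat.ceil_pos.2 hR
    positivity
  rw [Finset.mul_sum, Finset.mul_sum]
  refine Finset.sum_congr rfl fun m _ => ?_
  field_simp

/-! ### Temperate growth -/

theorem summable_one_add_abs_int_sq : Summable fun k : ℤ => 4 * ((1 + |(k : ℝ)|) ^ 2)⁻¹ := by
  have h1 := (Real.summable_abs_int_rpow (b := 2) one_lt_two).mul_left 4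
  have h2 := (hasSum_ite_eq (0 : ℤ) (4 : ℝ)).summable
  refine Summable.of_nonneg_of_le (fun k => by positivity) (fun k => ?_) (h1.add h2)
  by_cases hk : k = 0
  · simp [hk]
  · have hk' : 0 < |(k : ℝ)| := by simpa using hk
    rw [if_neg hk, add_zero, Real.rpow_neg hk'.le]
    gcongr
    norm_cast
    gcongr
    simp

/-- Shifting the index by `⌊x⌋` replaces `x` by its fractional part, and `1 + |fract x + k| ≥ (1 +
|k|)/2`. The bound is uniform in `x`, so it integrates against any finite measure. -/
theorem tsum_enorm_translates_le (x : ℝ) :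
    ∑' k : ℤ, ‖(1 + ‖x + k‖) ^ (-((2 : ℕ) : ℝ))‖ₑ ≤
      ∑' k : ℤ, ENNReal.ofReal (4 * ((1 + |(k : ℝ)|) ^ 2)⁻¹) := by
  rw [← (Equiv.addLeft (-⌊x⌋)).tsum_eq fun k : ℤ => ‖(1 + ‖x + k‖) ^ (-((2 : ℕ) : ℝ))‖ₑ]
  refine ENNReal.tsum_le_tsum fun k => ?_
  rw [← ofReal_norm, Real.norm_of_nonneg (by positivity), Real.rpow_neg (by positivity),
    Real.rpow_natCast]
  refine ENNReal.ofReal_le_ofReal ?_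
  have e : x + ((Equiv.addLeft (-⌊x⌋)) k : ℤ) = Int.fract x + k := by
    simp only [Equiv.coe_addLeft, Int.fract]
    push_cast
    ring
  rw [e]
  have h1 : (1 + |(k : ℝ)|) / 2 ≤ 1 + ‖Int.fract x + k‖ := by
    have h2 : |(k : ℝ)| ≤ |Int.fract x + k| + |Int.fract x| := by
      calc |(k : ℝ)| = |Int.fract x + k - Int.fract x| := by ring_nf
        _ ≤ _ := abs_sub _ _
    rw [Int.abs_fract] at h2
    have := (Int.fract_lt_one x).le
    have := abs_nonneg (Int.fract x + k)
    rw [Real.norm_eq_abs]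
    linarith
  calc ((1 + ‖Int.fract x + k‖) ^ 2)⁻¹ ≤ (((1 + |(k : ℝ)|) / 2) ^ 2)⁻¹ := by gcongr
    _ = 4 * ((1 + |(k : ℝ)|) ^ 2)⁻¹ := by
      rw [div_pow, inv_div]
      ring

theorem hasTemperateGrowth_periodization (μ : Measure ℝ) [IsFiniteMeasure μ] :
    (periodization μ).HasTemperateGrowth := by
  refine ⟨⟨2, ⟨?_, ?_⟩⟩⟩
  · exact (by fun_prop : Measurable fun x : ℝ => (1 + ‖x‖) ^ (-((2 : ℕ) : ℝ))).aestronglyMeasurable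
  · rw [HasFiniteIntegral, periodization, lintegral_sum_measure]
    have hm : Measurable fun x : ℝ => ‖(1 + ‖x‖) ^ (-((2 : ℕ) : ℝ))‖ₑ := by fun_prop
    have h1 : ∀ k : ℤ, ∫⁻ x, ‖(1 + ‖x‖) ^ (-((2 : ℕ) : ℝ))‖ₑ ∂(μ.map fun x => x + (k : ℝ)) =
        ∫⁻ x, ‖(1 + ‖x + k‖) ^ (-((2 : ℕ) : ℝ))‖ₑ ∂μ := fun k =>
      lintegral_map hm (measurable_add_const _)
    simp_rw [h1]
    have h2 : ∀ k : ℤ,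
        AEMeasurable (fun x : ℝ => ‖(1 + ‖x + k‖) ^ (-((2 : ℕ) : ℝ))‖ₑ) μ := fun k =>
      (hm.comp (measurable_add_const (k : ℝ))).aemeasurable
    rw [← lintegral_tsum h2]
    refine (lintegral_mono fun x => tsum_enorm_translates_le x).trans_lt ?_
    rw [lintegral_const]
    exact ENNReal.mul_lt_top summable_one_add_abs_int_sq.tsum_ofReal_lt_top (measure_lt_top _ _)

theorem periodization_dirac_zero :
    periodization (Measure.dirac 0) = Measure.sum fun k : ℤ => Measure.dirac (k : ℝ) := by
  unfold periodization
  congr 1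
  ext1 k
  rw [Measure.map_dirac' (measurable_add_const _), zero_add]

/-- Transfers temperate growth from the Dirac comb, which is the periodization of `δ_0`. -/
theorem latticeMeasure_le {c : ℤ → ℝ} (hc : ∀ m, c m ≤ 1) :
    latticeMeasure c ≤ periodization (Measure.dirac 0) := by
  rw [periodization_dirac_zero, Measure.le_iff]
  intro s hs
  rw [latticeMeasure, Measure.sum_apply _ hs, Measure.sum_apply _ hs]
  refine ENNReal.tsum_le_tsum fun m => ?_
  rw [Measure.smul_apply, smul_eq_mul]
  exact mul_le_of_le_one_left zero_le (ENNReal.ofReal_le_one.2 (hc m))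

theorem hasTemperateGrowth_latticeMeasure {c : ℤ → ℝ} (hc : ∀ m, c m ≤ 1) :
    (latticeMeasure c).HasTemperateGrowth := by
  obtain ⟨n, hn⟩ := (hasTemperateGrowth_periodization (Measure.dirac 0)).exists_integrable
  exact ⟨⟨n, hn.mono_measure (latticeMeasure_le hc)⟩⟩

/-- The integrable weight is bounded below on each unit ball. -/
theorem isLocallyFiniteMeasure_of_hasTemperateGrowth (μ : Measure ℝ) [h : μ.HasTemperateGrowth] :
    IsLocallyFiniteMeasure μ := by
  obtain ⟨n, hn⟩ := h.exists_integrable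
  refine ⟨fun x => ⟨Metric.ball x 1, Metric.ball_mem_nhds x one_pos, ?_⟩⟩
  have hpos : 0 < (2 + ‖x‖) ^ (-(n : ℝ)) := by positivity
  refine lt_of_le_of_lt (measure_mono fun y hy => ?_) (hn.measure_norm_ge_lt_top hpos)
  have hnn : 0 ≤ (1 + ‖y‖) ^ (-(n : ℝ)) := by positivity
  rw [Set.mem_ofPred_eq, Real.norm_of_nonneg hnn]
  refine Real.rpow_le_rpow_of_nonpos (by positivity) ?_ (neg_nonpos.2 (Nat.cast_nonneg n))
  have : ‖y‖ ≤ ‖x‖ + 1 := by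
    have h1 := norm_add_le x (y - x)
    rw [add_sub_cancel] at h1
    rw [Metric.mem_ball, dist_eq_norm] at hy
    linarith
  linarith

/-! ### Poisson summation for measures -/

/-- Absolute summability is integrability against the Dirac comb. -/
theorem summable_norm_schwartz_int (ψ : 𝓢(ℝ, ℂ)) : Summable fun m : ℤ => ‖ψ m‖ := by
  have := hasTemperateGrowth_periodization (Measure.dirac 0)
  have h := (ψ.integrable (μ := periodization (Measure.dirac 0))).norm
  rw [periodization_dirac_zero] at h
  simpa using (hasSum_integral_measure h).summable

theorem integral_periodization (μ : Measure ℝ) [IsFiniteMeasure μ] (φ : 𝓢(ℝ, ℂ)) :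
    ∫ x, φ x ∂(periodization μ) = ∫ x, ∑' k : ℤ, φ (x + k) ∂μ := by
  have := hasTemperateGrowth_periodization μ
  have h := φ.integrable (μ := periodization μ)
  have hmap : ∀ k : ℤ, MeasurableEmbedding fun x : ℝ => x + (k : ℝ) := fun k =>
    (MeasurableEquiv.addRight (k : ℝ)).measurableEmbedding
  have hi : ∀ k : ℤ, Integrable (fun x => φ (x + k)) μ := fun k =>
    (hmap k).integrable_map_iff.1 (h.mono_measure (Measure.le_sum _ k))
  have hs : Summable fun k : ℤ => ∫ x, ‖φ (x + k)‖ ∂μ := by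
    have := (hasSum_integral_measure h.norm).summable
    simpa only [fun k => (hmap k).integral_map (μ := μ) fun x => ‖φ x‖] using this
  rw [← integral_tsum_of_summable_integral_norm hi hs, periodization, integral_sum_measure h]
  exact tsum_congr fun k => (hmap k).integral_map _

/-- Poisson summation turns `∑ φ(x + k)` into `∑ 𝓕φ(m) e^{2πimx}`, and integrating over `μ` produces
the `c m`. The exchange is allowed because `μ` is finite and `∑ |𝓕φ(m)|` converges. -/
theorem fourier_latticeMeasure {μ : Measure ℝ} [IsFiniteMeasure μ] {c : ℤ → ℝ}
    (hc0 : ∀ m, 0 ≤ c m) (hc : ∀ m : ℤ, ∫ x : ℝ, fourier m (x : UnitAddCircle) ∂μ = c m)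
    [(latticeMeasure c).HasTemperateGrowth] [(periodization μ).HasTemperateGrowth] :
    𝓕 ((latticeMeasure c).toTemperedDistribution : 𝓢'(ℝ, ℂ)) =
      (periodization μ).toTemperedDistribution := by
  ext φ
  change ∫ x, (𝓕 φ) x ∂(latticeMeasure c) = ∫ x, φ x ∂(periodization μ)
  rw [integral_periodization]
  have h1 := (𝓕 φ).integrable (μ := latticeMeasure c)
  have hcont : ∀ m : ℤ, Continuous fun x : ℝ => fourier m (x : UnitAddCircle) := fun m =>
    (map_continuous _).comp (AddCircle.continuous_mk' 1)
  have hnorm : ∀ (m : ℤ) (x : ℝ), ‖fourier m (x : UnitAddCircle)‖ = 1 := fun m x =>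
    Circle.norm_coe _
  have hi : ∀ m : ℤ, Integrable (fun x : ℝ => 𝓕 φ (m : ℝ) * fourier m (x : UnitAddCircle)) μ :=
    fun m => ((integrable_const (1 : ℝ)).mono' (hcont m).aestronglyMeasurable
      (Eventually.of_forall fun x => (hnorm m x).le)).const_mul _
  simp_rw [SchwartzMap.tsum_eq_tsum_fourier]
  rw [← integral_tsum_of_summable_integral_norm hi, latticeMeasure, integral_sum_measure h1]
  · refine tsum_congr fun m => ?_
    rw [integral_smul_measure, integral_dirac, integral_const_mul, hc,
      ENNReal.toReal_ofReal (hc0 m), Complex.real_smul, mul_comm]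
  · simp_rw [norm_mul, hnorm, mul_one, integral_const, smul_eq_mul]
    exact (summable_norm_schwartz_int (𝓕 φ)).mul_left _

/-! ### The Fourier coefficients of `f(ν)` -/

section ArcsinMeasure

variable (ν : Measure ℝ) [IsProbabilityMeasure ν]

instance isProbabilityMeasure_convPower (k : ℕ) : IsProbabilityMeasure (convPower ν k) := by
  induction k with
  | zero => exact Measure.dirac.isProbabilityMeasure
  | succ k ih =>
    rw [convPower]
    infer_instance

theorem charFun_convPower (k : ℕ) (t : ℝ) : charFun (convPower ν k) t = charFun ν t ^ k := by
  induction k with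
  | zero => simp [convPower]
  | succ k ih => rw [convPower, charFun_conv, ih, pow_succ]

theorem charFun_eq_cosCoeff [ν.IsNegInvariant] (m : ℤ) :
    charFun ν (2 * Real.pi * m) = cosCoeff ν m := by
  have hc : Integrable (fun x => Real.cos (2 * Real.pi * m * x)) ν :=
    (integrable_const (1 : ℝ)).mono' (by fun_prop)
      (Eventually.of_forall fun x => Real.abs_cos_le_one _)
  have hs : Integrable (fun x => Real.sin (2 * Real.pi * m * x)) ν :=
    (integrable_const (1 : ℝ)).mono' (by fun_prop)
      (Eventually.of_forall fun x => Real.abs_sin_le_one _)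
  have e : ∀ x : ℝ, Complex.exp (((2 * Real.pi * m : ℝ) : ℂ) * x * Complex.I) =
      ((Real.cos (2 * Real.pi * m * x) : ℝ) : ℂ) +
        ((Real.sin (2 * Real.pi * m * x) : ℝ) : ℂ) * Complex.I := fun x => by
    rw [← Complex.ofReal_mul, Complex.exp_mul_I, Complex.ofReal_cos, Complex.ofReal_sin]
  rw [charFun_apply_real]
  simp_rw [e]
  rw [integral_add hc.ofReal (hs.ofReal.mul_const _), integral_mul_const,
    integral_complex_ofReal, integral_complex_ofReal,
    integral_odd_eq_zero ν (f := fun x => Real.sin (2 * Real.pi * m * x))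
      fun x => by rw [mul_neg, Real.sin_neg]]
  simp [cosCoeff]

instance isFiniteMeasure_arcsinMeasure : IsFiniteMeasure (arcsinMeasure ν) := by
  refine ⟨?_⟩
  rw [arcsinMeasure, Measure.sum_apply _ MeasurableSet.univ]
  simp only [Measure.smul_apply, measure_univ, smul_eq_mul, mul_one]
  exact summable_arcsinCoeff.tsum_ofReal_lt_top

/-- The `k`-th convolution power contributes `ν̂(m)^k`. The value `ν̂(0) = 1` is an endpoint, so the
series is needed on the closed interval. -/
theorem integral_fourier_arcsinMeasure [ν.IsNegInvariant] (m : ℤ) :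
    ∫ x : ℝ, fourier m (x : UnitAddCircle) ∂(arcsinMeasure ν) = arcsinFun (cosCoeff ν m) := by
  have e : ∀ x : ℝ, fourier m (x : UnitAddCircle) =
      Complex.exp (((2 * Real.pi * m : ℝ) : ℂ) * x * Complex.I) := fun x => by
    rw [fourier_coe_apply]
    congr 1
    push_cast
    ring
  have hi : Integrable (fun x : ℝ => Complex.exp (((2 * Real.pi * m : ℝ) : ℂ) * x * Complex.I))
      (arcsinMeasure ν) := by
    refine (integrable_const (1 : ℝ)).mono' (by fun_prop) (Eventually.of_forall fun x => ?_)
    rw [← Complex.ofReal_mul, Complex.norm_exp_ofReal_mul_I]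
  simp_rw [e]
  have h2 := hasSum_integral_measure hi
  refine h2.unique ?_
  have h3 := (hasSum_arcsinCoeff (abs_le.1 (abs_cosCoeff_le_one ν m))).map
    Complex.ofRealHom Complex.continuous_ofReal
  refine h3.congr_fun fun k => ?_
  rw [integral_smul_measure, ← charFun_apply_real, charFun_convPower, charFun_eq_cosCoeff,
    ENNReal.toReal_ofReal (arcsinCoeff_nonneg k)]
  simp

end ArcsinMeasure

/-! ### The diffraction measure of a binary sequence -/

theorem isAutocorrelation_latticeMeasure {χ : LocallyFiniteSet} {x : ℤ → Fin 2}
    (hχ : χ.carrier = {t : ℝ | ∃ k : ℤ, x k = 1 ∧ t = (k : ℝ)}) {c : ℤ → ℝ}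
    (hc0 : ∀ m, 0 ≤ c m) (hc1 : ∀ m, c m ≤ 1)
    (h1 : ∀ m, Tendsto (fun N : ℕ => (N : ℝ)⁻¹ * ∑ j ∈ Finset.range N, pairBit x m j) atTop
      (𝓝 (c m)))
    (h2 : ∀ m, Tendsto (fun N : ℕ => (N : ℝ)⁻¹ * ∑ j ∈ Finset.range N, pairBit x m (-j)) atTop
      (𝓝 (c m))) : IsAutocorrelation χ (latticeMeasure c) := by
  have := hasTemperateGrowth_latticeMeasure hc1
  have hlf := isLocallyFiniteMeasure_of_hasTemperateGrowth (latticeMeasure c)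
  refine ⟨hlf, fun g hg hgs => ?_⟩
  obtain ⟨B, hB⟩ := hgs.isCompact.isBounded.exists_norm_le
  have hg0 : ∀ m : ℤ, m ∉ Finset.Icc (-(⌈B⌉₊ : ℕ) : ℤ) ⌈B⌉₊ → g m = 0 := by
    intro m hm
    by_contra hne
    refine hm ?_
    have h3 := (hB m (subset_tsupport g hne)).trans (Nat.le_ceil B)
    rw [Real.norm_eq_abs, ← Int.cast_abs] at h3
    have h4 : |m| ≤ (⌈B⌉₊ : ℤ) := by exact_mod_cast h3
    exact Finset.mem_Icc.2 (abs_le.1 h4)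
  have h3 := tendsto_integral_autocorrelationAt hχ h1 h2 hg0
  have e : ∫ t, g t ∂(latticeMeasure c) =
      ∑ m ∈ Finset.Icc (-(⌈B⌉₊ : ℕ) : ℤ) ⌈B⌉₊, g m * c m := by
    have hi : Integrable g (latticeMeasure c) := hg.integrable_of_hasCompactSupport hgs
    rw [latticeMeasure, integral_sum_measure hi]
    simp_rw [integral_smul_measure, integral_dirac, ENNReal.toReal_ofReal (hc0 _), smul_eq_mul]
    rw [tsum_eq_sum (s := Finset.Icc (-(⌈B⌉₊ : ℕ) : ℤ) ⌈B⌉₊)]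
    · exact Finset.sum_congr rfl fun m _ => mul_comm _ _
    · intro m hm
      rw [hg0 m hm, mul_zero]
  rw [e]
  exact h3

theorem isDiffractionMeasure_periodization_arcsinMeasure {ν : Measure ℝ} [IsProbabilityMeasure ν]
    [ν.IsNegInvariant] {χ : LocallyFiniteSet} {x : ℤ → Fin 2}
    (hχ : χ.carrier = {t : ℝ | ∃ k : ℤ, x k = 1 ∧ t = (k : ℝ)})
    (h : ∀ m : ℤ,
      Tendsto (fun N : ℕ => (N : ℝ)⁻¹ * ∑ j ∈ Finset.range N, pairBit x m j) atTop
        (𝓝 (arcsinFun (cosCoeff ν m))) ∧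
      Tendsto (fun N : ℕ => (N : ℝ)⁻¹ * ∑ j ∈ Finset.range N, pairBit x m (-j)) atTop
        (𝓝 (arcsinFun (cosCoeff ν m)))) :
    IsDiffractionMeasure χ (periodization (arcsinMeasure ν)) := by
  have hγ := hasTemperateGrowth_latticeMeasure (c := fun m => arcsinFun (cosCoeff ν m))
    fun m => arcsinFun_le_one _
  have hD := hasTemperateGrowth_periodization (arcsinMeasure ν)
  exact ⟨latticeMeasure fun m => arcsinFun (cosCoeff ν m),
    isAutocorrelation_latticeMeasure hχ (fun m => arcsinFun_nonneg _) (fun m => arcsinFun_le_one _)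
      (fun m => (h m).1) (fun m => (h m).2), hγ, hD,
    fourier_latticeMeasure (fun m => arcsinFun_nonneg _) (integral_fourier_arcsinMeasure ν)⟩

/-! ### The random set attached to a binary process -/

theorem finite_setOf_intCast_inter (x : ℤ → Fin 2) {A : Set ℝ} (hA : Bornology.IsBounded A) :
    ({t : ℝ | ∃ k : ℤ, x k = 1 ∧ t = (k : ℝ)} ∩ A).Finite := by
  obtain ⟨B, hB⟩ := hA.exists_norm_le
  refine ((Set.finite_Icc (-⌈B⌉) ⌈B⌉).image fun k : ℤ => (k : ℝ)).subset ?_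
  rintro t ⟨⟨k, -, rfl⟩, hk⟩
  have h := (hB _ hk).trans (Int.le_ceil B)
  rw [Real.norm_eq_abs, ← Int.cast_abs] at h
  exact ⟨k, Set.mem_Icc.2 (abs_le.1 (by exact_mod_cast h)), rfl⟩

/-- The locally finite set of the integers `k` with `x k = 1`. -/
def LocallyFiniteSet.ofBits (x : ℤ → Fin 2) : LocallyFiniteSet where
  carrier := {t : ℝ | ∃ k : ℤ, x k = 1 ∧ t = (k : ℝ)}
  finite_inter _ hK := finite_setOf_intCast_inter x hK.isBounded

theorem LocallyFiniteSet.count_ofBits (x : ℤ → Fin 2) {A : Set ℝ} {B : ℤ}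
    (hB : ∀ k : ℤ, (k : ℝ) ∈ A → k ∈ Finset.Icc (-B) B) :
    LocallyFiniteSet.count A (LocallyFiniteSet.ofBits x) =
      ∑ k ∈ Finset.Icc (-B) B, A.indicator (fun _ => if x k = 1 then 1 else 0) (k : ℝ) := by
  classical
  have e : A ∩ (LocallyFiniteSet.ofBits x).carrier =
      ((((Finset.Icc (-B) B).filter fun k : ℤ => (k : ℝ) ∈ A ∧ x k = 1).map intEmbedding :
        Finset ℝ) : Set ℝ) := by
    ext t
    simp only [LocallyFiniteSet.ofBits, Finset.coe_map, Finset.coe_filter, Set.mem_image,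
      Set.mem_inter_iff, intEmbedding_apply]
    constructor
    · rintro ⟨hA, k, hk, rfl⟩
      exact ⟨k, ⟨hB k hA, hA, hk⟩, rfl⟩
    · rintro ⟨k, ⟨-, hA, hk⟩, rfl⟩
      exact ⟨hA, k, hk, rfl⟩
  rw [LocallyFiniteSet.count, e, Set.ncard_coe_finset, Finset.card_map, Finset.card_filter]
  refine Finset.sum_congr rfl fun k _ => ?_
  by_cases h : (k : ℝ) ∈ A <;> simp [h]

/-- For bounded `A` the count is a finite sum of functions of single coordinates. -/
theorem LocallyFiniteSet.measurable_ofBits : Measurable LocallyFiniteSet.ofBits := by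
  rw [measurable_iff_comap_le]
  simp only [instMeasurableSpaceLocallyFiniteSet, MeasurableSpace.comap_iSup,
    MeasurableSpace.comap_comp]
  refine iSup_le fun A => iSup_le fun hA => ?_
  obtain ⟨B, hB⟩ := hA.2.exists_norm_le
  have hB' : ∀ k : ℤ, (k : ℝ) ∈ A → k ∈ Finset.Icc (-⌈B⌉) ⌈B⌉ := fun k hk => by
    have h := (hB _ hk).trans (Int.le_ceil B)
    rw [Real.norm_eq_abs, ← Int.cast_abs] at h
    exact Finset.mem_Icc.2 (abs_le.1 (by exact_mod_cast h))
  have e : LocallyFiniteSet.count A ∘ LocallyFiniteSet.ofBits = fun x : ℤ → Fin 2 =>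
      ∑ k ∈ Finset.Icc (-⌈B⌉) ⌈B⌉, A.indicator (fun _ => if x k = 1 then 1 else 0) (k : ℝ) :=
    funext fun x => LocallyFiniteSet.count_ofBits x hB'
  rw [e]
  refine Measurable.comap_le (Finset.measurable_sum _ fun k _ => ?_)
  by_cases h : (k : ℝ) ∈ A
  · simp only [Set.indicator_of_mem h]
    exact Measurable.ite (measurable_pi_apply k (measurableSet_singleton 1))
      measurable_const measurable_const
  · simp only [Set.indicator_of_notMem h]
    exact measurable_const

/-- A stationary ergodic random set of integers with diffraction measure `f(ν)_p`. -/
theorem exists_randomSet_isDiffractionMeasure (ν : Measure ℝ) [IsProbabilityMeasure ν]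
    [NullSingletonClass ν] [ν.IsNegInvariant] :
    ∃ (Ω : Type) (_ : MeasurableSpace Ω) (P : Measure Ω) (X : ℤ → Ω → Fin 2)
      (χ : Ω → LocallyFiniteSet),
      IsProbabilityMeasure P ∧
      (∀ k : ℤ, Measurable (X k)) ∧
      Ergodic (fun (x : ℤ → Fin 2) (k : ℤ) => x (k + 1)) (P.map fun ω k => X k ω) ∧
      Measurable χ ∧
      (∀ ω, (χ ω).carrier = {t : ℝ | ∃ k : ℤ, X k ω = 1 ∧ t = (k : ℝ)}) ∧
      ∀ᵐ ω ∂P, IsDiffractionMeasure (χ ω) (periodization (arcsinMeasure ν)) := by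
  obtain ⟨Y, hY⟩ := exists_isCentredGaussian_cosCoeff ν
  have hm : Measurable fun ω k => posBit (Y k ω) := hY.measurable_posBit id
  refine ⟨ℕ → ℝ, inferInstance, gaussianNoise, fun k ω => posBit (Y k ω),
    fun ω => LocallyFiniteSet.ofBits fun k => posBit (Y k ω), inferInstance,
    fun k => (measurable_pi_apply k).comp hm, hY.ergodic_binaryShift,
    LocallyFiniteSet.measurable_ofBits.comp hm, fun ω => rfl, ?_⟩
  filter_upwards [hY.ae_tendsto_averages] with ω hω
  exact isDiffractionMeasure_periodization_arcsinMeasure rfl hω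

/-! ### Measures concentrated near finite sets -/

/-- `μ` gives no mass to the points at distance more than `r` from `F`. -/
def IsConcentratedNear (μ : Measure ℝ) (F : Finset ℝ) (r : ℝ) : Prop :=
  ∀ᵐ x ∂μ, ∃ p ∈ F, |x - p| ≤ r

theorem setOf_exists_abs_sub_le (F : Finset ℝ) (r : ℝ) :
    {x : ℝ | ∃ p ∈ F, |x - p| ≤ r} = ⋃ p ∈ F, Metric.closedBall p r := by
  ext x
  simp only [Set.mem_ofPred_eq, Set.mem_iUnion, exists_prop, Metric.mem_closedBall, Real.dist_eq]

theorem measurableSet_setOf_exists_abs_sub_le (F : Finset ℝ) (r : ℝ) :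
    MeasurableSet {x : ℝ | ∃ p ∈ F, |x - p| ≤ r} := by
  rw [setOf_exists_abs_sub_le]
  exact Finset.measurableSet_biUnion _ fun p _ => Metric.isClosed_closedBall.measurableSet

theorem IsConcentratedNear.conv {μ ν : Measure ℝ} [SFinite μ] [SFinite ν] {F G : Finset ℝ}
    {r s : ℝ} (hμ : IsConcentratedNear μ F r) (hν : IsConcentratedNear ν G s) :
    IsConcentratedNear (μ.conv ν) (Finset.image₂ (· + ·) F G) (r + s) := by
  have h1 : ∀ᵐ z ∂(μ.prod ν), ∃ p ∈ F, |z.1 - p| ≤ r := Measure.quasiMeasurePreserving_fst.ae hμ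
  have h2 : ∀ᵐ z ∂(μ.prod ν), ∃ p ∈ G, |z.2 - p| ≤ s := Measure.quasiMeasurePreserving_snd.ae hν
  rw [IsConcentratedNear, Measure.conv, ae_map_iff (by fun_prop)
    (measurableSet_setOf_exists_abs_sub_le _ _)]
  filter_upwards [h1, h2] with z ⟨p, hp, hp'⟩ ⟨q, hq, hq'⟩
  refine ⟨p + q, Finset.mem_image₂_of_mem hp hq, ?_⟩
  calc |z.1 + z.2 - (p + q)| = |(z.1 - p) + (z.2 - q)| := by ring_nf
    _ ≤ |z.1 - p| + |z.2 - q| := abs_add_le _ _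
    _ ≤ r + s := add_le_add hp' hq'

/-- Under convolution, cardinalities multiply and radii add. -/
theorem IsConcentratedNear.convPower {ν : Measure ℝ} [IsProbabilityMeasure ν] {F : Finset ℝ}
    {r : ℝ} (hν : IsConcentratedNear ν F r) (k : ℕ) :
    ∃ G : Finset ℝ, G.card ≤ F.card ^ k ∧ IsConcentratedNear (convPower ν k) G (k * r) := by
  induction k with
  | zero =>
    refine ⟨{0}, by simp, ?_⟩
    rw [IsConcentratedNear, _root_.convPower, ae_dirac_eq]
    exact ⟨0, by simp⟩
  | succ k ih =>
    obtain ⟨G, hG, hG'⟩ := ih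
    refine ⟨Finset.image₂ (· + ·) G F, ?_, ?_⟩
    · rw [pow_succ]
      exact (Finset.card_image₂_le _ _ _).trans (Nat.mul_le_mul_right _ hG)
    · have h := hG'.conv hν
      rw [Nat.cast_succ, add_one_mul]
      exact h

theorem volume_biUnion_closedBall_le (F : Finset ℝ) (r : ℝ) :
    volume (⋃ p ∈ F, Metric.closedBall p r) ≤ F.card * ENNReal.ofReal (2 * r) := by
  refine (measure_biUnion_finset_le F _).trans ?_
  simp_rw [Real.volume_closedBall]
  rw [Finset.sum_const, nsmul_eq_mul]

/-- The intersection of all the neighbourhoods carries `μ`, and its length is below every term of a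
null sequence. -/
theorem mutuallySingular_volume_of_isConcentratedNear {μ : Measure ℝ} {F : ℕ → Finset ℝ}
    {r : ℕ → ℝ} (h : ∀ N, IsConcentratedNear μ (F N) (r N))
    (hF : Tendsto (fun N => ((F N).card : ℝ) * (2 * r N)) atTop (𝓝 0)) :
    μ.MutuallySingular volume := by
  refine Measure.MutuallySingular.mk (s := (⋂ N, ⋃ p ∈ F N, Metric.closedBall p (r N))ᶜ)
    (t := ⋂ N, ⋃ p ∈ F N, Metric.closedBall p (r N)) ?_ ?_ (by rw [Set.compl_union_self])
  · have h1 : ∀ᵐ x ∂μ, ∀ N, ∃ p ∈ F N, |x - p| ≤ r N := ae_all_iff.2 h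
    have e : (⋂ N, ⋃ p ∈ F N, Metric.closedBall p (r N)) =
        {x : ℝ | ∀ N, ∃ p ∈ F N, |x - p| ≤ r N} := by
      ext x
      simp only [Set.mem_iInter, Set.mem_iUnion, exists_prop, Metric.mem_closedBall, Real.dist_eq,
        Set.mem_ofPred_eq]
    rw [e]
    exact h1
  · refine le_antisymm (ge_of_tendsto' (x := atTop)
      (f := fun N => ENNReal.ofReal ((F N).card * (2 * r N))) ?_ fun N => ?_) zero_le
    · rw [← ENNReal.ofReal_zero]
      exact ENNReal.tendsto_ofReal hF
    · refine (measure_mono (Set.iInter_subset _ N)).trans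
        ((volume_biUnion_closedBall_le _ _).trans ?_)
      rw [ENNReal.ofReal_mul (Nat.cast_nonneg _), ENNReal.ofReal_natCast]

/-! ### Periodizations -/

theorem periodization_add (μ ν : Measure ℝ) :
    periodization (μ + ν) = periodization μ + periodization ν := by
  unfold periodization
  rw [Measure.sum_add_sum]
  congr 1
  ext1 k
  exact Measure.map_add _ _ (measurable_add_const _)

theorem map_add_one_periodization (μ : Measure ℝ) :
    (periodization μ).map (fun x => x + 1) = periodization μ := by
  unfold periodization
  ext s hs
  rw [Measure.map_apply (measurable_add_const _) hs,
    Measure.sum_apply _ (measurable_add_const _ hs), Measure.sum_apply _ hs,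
    ← (Equiv.addRight (1 : ℤ)).tsum_eq fun k : ℤ => (μ.map fun x => x + (k : ℝ)) s]
  refine tsum_congr fun k => ?_
  rw [Measure.map_apply (measurable_add_const _) (measurable_add_const _ hs),
    Measure.map_apply (measurable_add_const _) hs]
  congr 1
  ext x
  simp [add_assoc]

theorem nullSingletonClass_periodization (μ : Measure ℝ) [NullSingletonClass μ] :
    NullSingletonClass (periodization μ) := by
  refine ⟨fun a => ?_⟩
  rw [periodization, Measure.sum_apply _ (measurableSet_singleton a), ENNReal.tsum_eq_zero]
  intro k
  rw [Measure.map_apply (measurable_add_const _) (measurableSet_singleton a)]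
  have : (fun x : ℝ => x + k) ⁻¹' {a} = {a - k} := by
    ext x
    rw [Set.mem_preimage, Set.mem_singleton_iff, Set.mem_singleton_iff, eq_sub_iff_add_eq]
  rw [this, measure_singleton]

theorem mutuallySingular_periodization {μ : Measure ℝ} (h : μ.MutuallySingular volume) :
    (periodization μ).MutuallySingular volume := by
  refine Measure.MutuallySingular.sum_left.2 fun k => ?_
  have h1 := (MeasurableEquiv.addRight (k : ℝ)).measurableEmbedding.mutuallySingular_map h
  have h2 : (volume : Measure ℝ).map (MeasurableEquiv.addRight (k : ℝ)) = volume :=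
    (measurePreserving_add_right volume (k : ℝ)).map_eq
  rw [h2] at h1
  exact h1

theorem periodization_ne_zero {μ : Measure ℝ} (h : μ ≠ 0) : periodization μ ≠ 0 := by
  intro h0
  refine h ?_
  rw [periodization, Measure.sum_eq_zero] at h0
  simpa using h0 0

/-! ### The continuous part of `f(ν)` -/

/-- One atomless factor suffices, so every power from the first on is atomless although the zeroth
is `δ_0`. -/
instance nullSingletonClass_conv (μ ν : Measure ℝ) [SFinite μ] [SFinite ν]
    [NullSingletonClass ν] : NullSingletonClass (μ.conv ν) := by
  refine ⟨fun a => ?_⟩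
  rw [Measure.conv, Measure.map_apply (by fun_prop) (measurableSet_singleton a),
    Measure.measure_prod_null ((by fun_prop : Measurable fun x : ℝ × ℝ => x.1 + x.2)
      (measurableSet_singleton a))]
  refine Eventually.of_forall fun x => ?_
  have : Prod.mk x ⁻¹' ((fun x : ℝ × ℝ => x.1 + x.2) ⁻¹' {a}) = {a - x} := by
    ext y
    simp [eq_sub_iff_add_eq, add_comm]
  beta_reduce
  rw [this, measure_singleton, Pi.zero_apply]

theorem nullSingletonClass_arcsinMeasureTail (ν : Measure ℝ) [IsProbabilityMeasure ν]
    [NullSingletonClass ν] : NullSingletonClass (arcsinMeasureTail ν) := by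
  refine ⟨fun a => ?_⟩
  rw [arcsinMeasureTail, Measure.sum_apply _ (measurableSet_singleton a), ENNReal.tsum_eq_zero]
  intro k
  rw [Measure.smul_apply, convPower, measure_singleton, smul_zero]

theorem arcsinCoeff_zero : arcsinCoeff 0 = 1 / 4 := by
  simp [arcsinCoeff, arcsinFun]

theorem arcsinCoeff_one_pos : 0 < arcsinCoeff 1 := by
  rw [arcsinCoeff_eq, arcsinSeriesCoeff]
  have : invSqrtCoeff 0 = 1 := by simp [invSqrtCoeff]
  rw [this]
  have := Real.pi_pos
  positivity

theorem arcsinMeasure_eq_add_tail (ν : Measure ℝ) :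
    arcsinMeasure ν = ENNReal.ofReal (1 / 4) • Measure.dirac 0 + arcsinMeasureTail ν := by
  ext s hs
  rw [arcsinMeasure, arcsinMeasureTail, Measure.add_apply, Measure.sum_apply _ hs,
    Measure.sum_apply _ hs, tsum_eq_zero_add' ENNReal.summable, arcsinCoeff_zero, convPower]

theorem periodization_arcsinMeasure (ν : Measure ℝ) :
    periodization (arcsinMeasure ν) =
      (Measure.sum fun k : ℤ => ENNReal.ofReal (1 / 4) • Measure.dirac (k : ℝ)) +
        periodization (arcsinMeasureTail ν) := by
  rw [arcsinMeasure_eq_add_tail, periodization_add]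
  congr 1
  unfold periodization
  congr 1
  ext1 k
  rw [Measure.map_smul, Measure.map_dirac' (measurable_add_const _), zero_add]

theorem arcsinMeasureTail_ne_zero (ν : Measure ℝ) [IsProbabilityMeasure ν] :
    arcsinMeasureTail ν ≠ 0 := by
  intro h
  rw [arcsinMeasureTail, Measure.sum_eq_zero] at h
  have h1 := congrArg (fun μ : Measure ℝ => μ Set.univ) (h 0)
  simp only [Measure.smul_apply, measure_univ, smul_eq_mul, mul_one, Measure.coe_zero,
    Pi.zero_apply, ENNReal.ofReal_eq_zero, zero_add] at h1
  exact absurd h1 (not_le.2 arcsinCoeff_one_pos)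

theorem mutuallySingular_arcsinMeasureTail {ν : Measure ℝ}
    (h : ∀ k, (convPower ν k).MutuallySingular volume) :
    (arcsinMeasureTail ν).MutuallySingular volume :=
  Measure.MutuallySingular.sum_left.2 fun k => (h (k + 1)).smul _

/-! ### Random signs -/

instance isProbabilityMeasure_signLaw : IsProbabilityMeasure signLaw := by
  refine ⟨?_⟩
  rw [signLaw, Measure.add_apply, Measure.smul_apply, Measure.smul_apply, measure_univ,
    measure_univ, smul_eq_mul, mul_one, ENNReal.inv_two_add_inv_two]

theorem ae_signLaw : ∀ᵐ x ∂signLaw, x = 1 ∨ x = -1 := by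
  rw [signLaw, ae_add_measure_iff]
  constructor <;> refine Measure.ae_smul_measure ?_ _ <;> rw [ae_dirac_eq]
  · exact Or.inl rfl
  · exact Or.inr rfl

theorem map_neg_signLaw : signLaw.map (fun x => -x) = signLaw := by
  rw [signLaw, Measure.map_add _ _ measurable_neg, Measure.map_smul, Measure.map_smul,
    Measure.map_dirac' measurable_neg, Measure.map_dirac' measurable_neg, neg_neg, add_comm]

theorem signLaw_singleton_le (a : ℝ) : signLaw {a} ≤ 2⁻¹ := by
  rw [signLaw, Measure.add_apply, Measure.smul_apply, Measure.smul_apply,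
    Measure.dirac_apply' _ (measurableSet_singleton a),
    Measure.dirac_apply' _ (measurableSet_singleton a)]
  by_cases h : (1 : ℝ) = a
  · subst h
    have : (-1 : ℝ) ≠ 1 := by norm_num
    simp [this]
  · by_cases h' : (-1 : ℝ) = a <;> simp [h, h']

/-- The law of a sequence of independent uniform random signs. -/
noncomputable def randomSigns : Measure (ℕ → ℝ) := Measure.infinitePi fun _ : ℕ => signLaw

theorem ae_randomSigns : ∀ᵐ x ∂randomSigns, ∀ n, x n = 1 ∨ x n = -1 := by
  refine ae_all_iff.2 fun n => ?_
  exact (measurePreserving_eval_infinitePi (fun _ : ℕ => signLaw) n).quasiMeasurePreserving.ae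
    ae_signLaw

/-- Fixing the first `N` signs leaves mass at most `2^{-N}`. -/
theorem randomSigns_singleton (x : ℕ → ℝ) : randomSigns {x} = 0 := by
  have h : ∀ N : ℕ, randomSigns {x} ≤ (2⁻¹ : ENNReal) ^ N := fun N => by
    have h1 : randomSigns {x} ≤ randomSigns (Set.pi (Finset.range N) fun n => {x n}) :=
      measure_mono (Set.singleton_subset_iff.2 fun n _ => rfl)
    refine h1.trans ?_
    rw [randomSigns, Measure.infinitePi_pi _ fun n _ => measurableSet_singleton (x n)]
    refine (Finset.prod_le_pow_card _ _ _ fun n _ => signLaw_singleton_le (x n)).trans ?_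
    rw [Finset.card_range]
  refine le_antisymm (ge_of_tendsto' (x := atTop) ?_ h) zero_le
  exact ENNReal.tendsto_pow_atTop_nhds_zero_of_lt_one (by simp)

/-! ### The weights -/

/-- The weights of the random series. -/
noncomputable def signWeight (n : ℕ) : ℝ := 1 / ((n : ℝ) + 1) ^ (n + 1)

theorem signWeight_pos (n : ℕ) : 0 < signWeight n := by
  unfold signWeight
  positivity

/-- Gives geometric control of the tails; strictness is what separates distinct sign sequences. -/
theorem signWeight_succ_lt (n : ℕ) : 2 * signWeight (n + 1) < signWeight n := by
  unfold signWeight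
  rw [mul_one_div, div_lt_div_iff₀ (by positivity) (by positivity), one_mul, pow_succ _ (n + 1)]
  push_cast
  have hn : (0 : ℝ) ≤ n := Nat.cast_nonneg n
  calc 2 * ((n : ℝ) + 1) ^ (n + 1) < 2 * ((n : ℝ) + 1 + 1) ^ (n + 1) := by
        gcongr
        linarith
    _ ≤ (n + 1 + 1) * ((n : ℝ) + 1 + 1) ^ (n + 1) := by
        gcongr
        linarith
    _ = _ := mul_comm _ _

theorem signWeight_add_le (N m : ℕ) : signWeight (N + m) ≤ signWeight N * (1 / 2) ^ m := by
  induction m with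
  | zero => simp
  | succ m ih =>
    have := signWeight_succ_lt (N + m)
    rw [pow_succ, ← mul_assoc, ← add_assoc]
    linarith

theorem summable_signWeight (N : ℕ) : Summable fun m => signWeight (N + m) :=
  Summable.of_nonneg_of_le (fun _ => (signWeight_pos _).le) (signWeight_add_le N)
    (summable_geometric_two.mul_left _)

theorem tsum_signWeight_le (N : ℕ) : ∑' m, signWeight (N + m) ≤ 2 * signWeight N := by
  refine ((summable_signWeight N).tsum_le_tsum (signWeight_add_le N)
    (summable_geometric_two.mul_left _)).trans ?_
  rw [tsum_mul_left, tsum_geometric_two, mul_comm]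

/-! ### The random series -/

/-- The series of the terms `x n / (n + 1) ^ (n + 1)`. -/
noncomputable def signSeries (x : ℕ → ℝ) : ℝ := ∑' n : ℕ, x n / ((n : ℝ) + 1) ^ (n + 1)

theorem signSeries_eq (x : ℕ → ℝ) : signSeries x = ∑' n, x n * signWeight n := by
  simp only [signSeries, signWeight, mul_one_div]

theorem summable_mul_signWeight {x : ℕ → ℝ} {B : ℝ} (hx : ∀ n, |x n| ≤ B) (N : ℕ) :
    Summable fun m => x (N + m) * signWeight (N + m) := by
  refine Summable.of_norm_bounded ((summable_signWeight N).mul_left B) fun m => ?_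
  rw [norm_mul, Real.norm_eq_abs, Real.norm_of_nonneg (signWeight_pos _).le]
  exact mul_le_mul_of_nonneg_right (hx _) (signWeight_pos _).le

theorem abs_tsum_mul_signWeight_le {x : ℕ → ℝ} {B : ℝ} (hx : ∀ n, |x n| ≤ B) (N : ℕ) :
    |∑' m, x (N + m) * signWeight (N + m)| ≤ B * (2 * signWeight N) := by
  have hB : 0 ≤ B := (abs_nonneg _).trans (hx 0)
  have h := tsum_of_norm_bounded (f := fun m => x (N + m) * signWeight (N + m))
    ((summable_signWeight N).mul_left B).hasSum fun m => by
      rw [norm_mul, Real.norm_eq_abs, Real.norm_of_nonneg (signWeight_pos _).le]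
      exact mul_le_mul_of_nonneg_right (hx _) (signWeight_pos _).le
  rw [tsum_mul_left] at h
  exact h.trans (mul_le_mul_of_nonneg_left (tsum_signWeight_le N) hB)

theorem signSeries_eq_sum_add {x : ℕ → ℝ} {B : ℝ} (hx : ∀ n, |x n| ≤ B) (N : ℕ) :
    signSeries x = ∑ n ∈ Finset.range N, x n * signWeight n +
      ∑' m, x (N + m) * signWeight (N + m) := by
  have h : Summable fun n => x n * signWeight n := by
    simpa only [zero_add] using summable_mul_signWeight hx 0
  rw [signSeries_eq, ← h.sum_add_tsum_nat_add N]
  simp only [add_comm]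

theorem abs_le_one_of_signs {x : ℕ → ℝ} (hx : ∀ n, x n = 1 ∨ x n = -1) (n : ℕ) : |x n| ≤ 1 := by
  rcases hx n with h | h <;> simp [h]

/-- At the first disagreement `n` the terms differ by `2 w_n`, while the two tails together
contribute at most `4 w_{n+1} < 2 w_n`. -/
theorem signSeries_injOn : Set.InjOn signSeries {x | ∀ n, x n = 1 ∨ x n = -1} := by
  intro x hx y hy hxy
  by_contra hne
  have hex : ∃ n, x n ≠ y n := Function.ne_iff.1 hne
  classical
  set n := Nat.find hex with hn
  have hn1 : x n ≠ y n := Nat.find_spec hex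
  have hn2 : ∀ m < n, x m = y m := fun m hm => not_not.1 (Nat.find_min hex hm)
  have hx1 := abs_le_one_of_signs hx
  have hy1 := abs_le_one_of_signs hy
  have ex := signSeries_eq_sum_add hx1 (n + 1)
  have ey := signSeries_eq_sum_add hy1 (n + 1)
  rw [Finset.sum_range_succ] at ex ey
  have es : ∑ m ∈ Finset.range n, x m * signWeight m = ∑ m ∈ Finset.range n, y m * signWeight m :=
    Finset.sum_congr rfl fun m hm => by rw [hn2 m (Finset.mem_range.1 hm)]
  have bx := abs_le.1 (abs_tsum_mul_signWeight_le hx1 (n + 1))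
  have bY := abs_le.1 (abs_tsum_mul_signWeight_le hy1 (n + 1))
  have hw := signWeight_succ_lt n
  have hw' := signWeight_pos n
  rcases hx n with h1 | h1 <;> rcases hy n with h2 | h2 <;> rw [h1, h2] at hn1 <;>
    first
    | exact hn1 rfl
    | (rw [h1] at ex; rw [h2] at ey; linarith [bx.1, bx.2, bY.1, bY.2])

/-- The series is the limit of its partial sums on sign sequences, which have full measure. -/
theorem aemeasurable_signSeries : AEMeasurable signSeries randomSigns := by
  refine aemeasurable_of_tendsto_metrizable_ae atTop
    (f := fun N x => ∑ n ∈ Finset.range N, x n * signWeight n) (fun N => ?_) ?_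
  · have h : ∀ n, Measurable fun x : ℕ → ℝ => x n * signWeight n := fun n =>
      (measurable_pi_apply n).mul_const _
    exact (Finset.measurable_sum _ fun n _ => h n).aemeasurable
  · filter_upwards [ae_randomSigns] with x hx
    have h : Summable fun n => x n * signWeight n := by
      simpa only [zero_add] using summable_mul_signWeight (abs_le_one_of_signs hx) 0
    rw [signSeries_eq]
    exact h.hasSum.tendsto_sum_nat

theorem signSeriesLaw_eq : signSeriesLaw = randomSigns.map signSeries := rfl

instance isProbabilityMeasure_signSeriesLaw : IsProbabilityMeasure signSeriesLaw :=
  Measure.isProbabilityMeasure_map aemeasurable_signSeries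

/-- By injectivity each fibre contains at most one sign sequence, and single sequences are null. -/
instance nullSingletonClass_signSeriesLaw : NullSingletonClass signSeriesLaw := by
  refine ⟨fun a => ?_⟩
  rw [signSeriesLaw_eq, Measure.map_apply_of_aemeasurable aemeasurable_signSeries
    (measurableSet_singleton a)]
  have hsub : ∃ y : ℕ → ℝ, signSeries ⁻¹' {a} ∩ {x | ∀ n, x n = 1 ∨ x n = -1} ⊆ {y} := by
    by_cases hne : (signSeries ⁻¹' {a} ∩ {x | ∀ n, x n = 1 ∨ x n = -1}).Nonempty
    · obtain ⟨y, hy, hy'⟩ := hne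
      refine ⟨y, fun x hx => signSeries_injOn hx.2 hy' ?_⟩
      exact (Set.mem_singleton_iff.1 hx.1).trans (Set.mem_singleton_iff.1 hy).symm
    · exact ⟨0, by rw [Set.not_nonempty_iff_eq_empty.1 hne]; exact Set.empty_subset _⟩
  obtain ⟨y, hy⟩ := hsub
  refine measure_mono_null (t := {y} ∪ {x | ∀ n, x n = 1 ∨ x n = -1}ᶜ) (fun x hx => ?_)
    (measure_union_null (randomSigns_singleton y) ae_randomSigns)
  by_cases h : x ∈ {x : ℕ → ℝ | ∀ n, x n = 1 ∨ x n = -1}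
  · exact Or.inl (hy ⟨hx, h⟩)
  · exact Or.inr h

theorem map_neg_randomSigns : randomSigns.map (fun x n => -x n) = randomSigns := by
  rw [randomSigns, Measure.infinitePi_map_pi (f := fun _ x => -x) _ fun _ => measurable_neg]
  simp only [map_neg_signLaw]

instance isNegInvariant_signSeriesLaw : signSeriesLaw.IsNegInvariant := by
  refine ⟨?_⟩
  have hm : Measurable fun (x : ℕ → ℝ) (n : ℕ) => -x n :=
    measurable_pi_lambda _ fun n => (measurable_pi_apply n).neg
  have hodd : ∀ x, signSeries (fun n => -x n) = -signSeries x := fun x => by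
    simp only [signSeries, neg_div, tsum_neg]
  have h1 : (randomSigns.map fun x n => -x n).map signSeries =
      randomSigns.map (signSeries ∘ fun x n => -x n) := by
    refine AEMeasurable.map_map_of_aemeasurable ?_ hm.aemeasurable
    rw [map_neg_randomSigns]
    exact aemeasurable_signSeries
  rw [map_neg_randomSigns] at h1
  rw [Measure.neg_def, signSeriesLaw_eq,
    AEMeasurable.map_map_of_aemeasurable measurable_neg.aemeasurable aemeasurable_signSeries, h1]
  exact congrArg (fun f => randomSigns.map f) (funext fun x => (hodd x).symm)

theorem exists_finset_sum_signs (N : ℕ) : ∃ F : Finset ℝ, F.card ≤ 2 ^ N ∧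
    ∀ x : ℕ → ℝ, (∀ n, x n = 1 ∨ x n = -1) → ∑ n ∈ Finset.range N, x n * signWeight n ∈ F := by
  induction N with
  | zero => exact ⟨{0}, by simp, by simp⟩
  | succ N ih =>
    obtain ⟨F, hF, hF'⟩ := ih
    refine ⟨Finset.image₂ (· + ·) F {signWeight N, -signWeight N}, ?_, fun x hx => ?_⟩
    · rw [pow_succ]
      exact (Finset.card_image₂_le _ _ _).trans (Nat.mul_le_mul hF Finset.card_le_two)
    · rw [Finset.sum_range_succ]
      refine Finset.mem_image₂_of_mem (hF' x hx) ?_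
      rcases hx N with h | h <;> simp [h]

theorem isConcentratedNear_signSeriesLaw (N : ℕ) : ∃ F : Finset ℝ, F.card ≤ 2 ^ N ∧
    IsConcentratedNear signSeriesLaw F (2 * signWeight N) := by
  obtain ⟨F, hF, hF'⟩ := exists_finset_sum_signs N
  refine ⟨F, hF, ?_⟩
  rw [IsConcentratedNear, signSeriesLaw_eq, ae_map_iff aemeasurable_signSeries
    (measurableSet_setOf_exists_abs_sub_le _ _)]
  filter_upwards [ae_randomSigns] with x hx
  refine ⟨_, hF' x hx, ?_⟩
  have h1 := abs_le_one_of_signs hx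
  rw [signSeries_eq_sum_add h1 N, add_sub_cancel_left]
  exact (abs_tsum_mul_signWeight_le h1 N).trans_eq (one_mul _)

/-- For `N ≥ 2^k` the number of points is at most `(2^N)^k = (2^k)^N ≤ (N+1)^N`, while each interval
has length `4k (N+1)^{-(N+1)}`. The total is at most `4k/(N+1)`. -/
theorem mutuallySingular_convPower_signSeriesLaw (k : ℕ) :
    (convPower signSeriesLaw k).MutuallySingular volume := by
  choose F hF hF' using isConcentratedNear_signSeriesLaw
  choose G hG hG' using fun N => (hF' N).convPower k
  refine mutuallySingular_volume_of_isConcentratedNear hG' ?_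
  have hlim : Tendsto (fun N : ℕ => 4 * (k : ℝ) * (1 / ((N : ℝ) + 1))) atTop (𝓝 0) := by
    simpa using (tendsto_one_div_add_atTop_nhds_zero_nat (𝕜 := ℝ)).const_mul (4 * (k : ℝ))
  refine squeeze_zero' (Eventually.of_forall fun N => ?_) ?_ hlim
  · have := signWeight_pos N
    positivity
  · filter_upwards [eventually_ge_atTop (2 ^ k)] with N hN
    have h1 : ((G N).card : ℝ) ≤ ((N : ℝ) + 1) ^ N := by
      have h2 : (G N).card ≤ (N + 1) ^ N := by
        refine (hG N).trans ((Nat.pow_le_pow_left (hF N) k).trans ?_)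
        rw [← pow_mul, mul_comm, pow_mul]
        exact Nat.pow_le_pow_left (hN.trans (Nat.le_succ N)) N
      exact_mod_cast h2
    have hw := signWeight_pos N
    calc ((G N).card : ℝ) * (2 * (k * (2 * signWeight N)))
        ≤ ((N : ℝ) + 1) ^ N * (2 * (k * (2 * signWeight N))) := by gcongr
      _ = 4 * (k : ℝ) * (((N : ℝ) + 1) ^ N / ((N : ℝ) + 1) ^ (N + 1)) := by
        rw [signWeight]
        ring
      _ = 4 * (k : ℝ) * (1 / ((N : ℝ) + 1)) := by
        rw [pow_succ, div_mul_eq_div_div, div_self (by positivity)]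

theorem mainTheorem6 :
    -- `f` is the sum of its power series on `[-1,1]`, with nonnegative coefficients
    ((∀ k : ℕ, 0 ≤ arcsinCoeff k) ∧
      ∀ x ∈ Set.Icc (-1 : ℝ) 1, HasSum (fun k : ℕ => arcsinCoeff k * x ^ k) (arcsinFun x)) ∧
    -- the diffraction measure `μ_p` is realized by a stationary ergodic random subset of `ℤ`
    (∀ ν : Measure ℝ, IsProbabilityMeasure ν → NullSingletonClass ν → ν.IsNegInvariant →
      ∃ (Ω : Type) (_ : MeasurableSpace Ω) (P : Measure Ω) (X : ℤ → Ω → Fin 2)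
        (χ : Ω → LocallyFiniteSet),
        IsProbabilityMeasure P ∧
        (∀ k : ℤ, Measurable (X k)) ∧
        Ergodic (fun (x : ℤ → Fin 2) (k : ℤ) => x (k + 1)) (P.map fun ω k => X k ω) ∧
        Measurable χ ∧
        (∀ ω, (χ ω).carrier = {t : ℝ | ∃ k : ℤ, X k ω = 1 ∧ t = (k : ℝ)}) ∧
        ∀ᵐ ω ∂P, IsDiffractionMeasure (χ ω) (periodization (arcsinMeasure ν))) ∧
    -- the example with a purely singular continuous component
    (IsProbabilityMeasure signSeriesLaw ∧ NullSingletonClass signSeriesLaw ∧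
      signSeriesLaw.IsNegInvariant ∧
      periodization (arcsinMeasure signSeriesLaw) =
        (Measure.sum fun k : ℤ => ENNReal.ofReal (1 / 4) • Measure.dirac (k : ℝ)) +
          periodization (arcsinMeasureTail signSeriesLaw) ∧
      periodization (arcsinMeasureTail signSeriesLaw) ≠ 0 ∧
      NullSingletonClass (periodization (arcsinMeasureTail signSeriesLaw)) ∧
      (periodization (arcsinMeasureTail signSeriesLaw)).MutuallySingular volume ∧
      (periodization (arcsinMeasureTail signSeriesLaw)).map (fun x => x + 1) =
        periodization (arcsinMeasureTail signSeriesLaw)) := by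
  refine ⟨⟨arcsinCoeff_nonneg, fun x hx => hasSum_arcsinCoeff hx⟩, fun ν h1 h2 h3 =>
    exists_randomSet_isDiffractionMeasure ν, inferInstance, inferInstance, inferInstance,
    periodization_arcsinMeasure _, periodization_ne_zero (arcsinMeasureTail_ne_zero _), ?_,
    mutuallySingular_periodization
      (mutuallySingular_arcsinMeasureTail mutuallySingular_convPower_signSeriesLaw),
    map_add_one_periodization _⟩
  have := nullSingletonClass_arcsinMeasureTail signSeriesLaw
  exact nullSingletonClass_periodization _
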